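/- **Setting.** Let $(\mathcal X,\mathcal G)$, $(\mathcal Y,\mathcal F)$, $(\mathcal Z_1,\mathcal H_1),\dots,(\mathcal Z_d,\mathcal H_d)$, $d\ge 1$, be measurable spaces. A RIS-assisted wiretap channel with RIS configuration $\theta$ consists of a Markov kernel $K_{AB}$ from $\mathcal X^2$ to $\mathcal Y^2$ (Bob) of product form $K_{AB}(A_1\times A_2,(x_1,x_2))=K_{AB,1}(A_1,x_1)\,K^{(\theta)}_{AB,2}(A_2,x_2)$, and of Markov kernels $K_{AE_j}=K_{AE_j}^{(\theta)}$ from $\mathcal X^2$ to $\mathcal Z_j$ (Eve$_j$), $j=1,\dots,d$. For a Markov kernel $K$ let $K^{\otimes n}(\cdot,x^n)=\bigotimes_{i=1}^nK(\cdot,x_i)$. Let $Q_X$ be a probability measure on $\mathcal X^2$ (input law). Let $Q_Y,Q_{Z_j}$ be the induced output laws and $Q_{XY},Q_{XZ_j}$ the joint laws of input and output. For an output $V\in\{Y,Z_1,\dots,Z_d\}$ with kernel $K$, the information density is $i[x;v]=\log\frac{dK(\cdot,x)}{dQ_V}(v)$. It is said to exist if $K(\cdot,x)\ll Q_V$ for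 $Q_X$-almost every $x$, with densities that have a version measurable in $(x,v)$; such a version is used. $I[X;V]$ is the mutual information, i.e. the Kullback–Leibler divergence of $Q_{XV}$ from $Q_X\otimes Q_V$. Logarithms are natural. For $L,L_1\ge1$ a codebook $\mathcal C_n$ is a family $x^n(m,w)\in(\mathcal X^2)^n$, $1\le m\le L$, $1\le w\le L_1$; to send $m$, the encoder picks $w$ uniformly and sends $x^n(m,w)$. Given $m$, the output of Eve$_j$ has law $P_{Z_j^n|X^n(m,\cdot)}=\frac1{L_1}\sum_wK_{AE_j}^{\otimes n}(\cdot,x^n(m,w))$. For a measurable decoder $D_n:(\mathcal Y^2)^n\to\{1,\dots,L\}$ the average error is $$P_{\mathcal E}(\mathcal C_n,D_n)=\frac1{LL_1}\sum_{w,m}K_{AB}^{\otimes n}(\{y^n:D_n(y^n)\ne m\},x^n(m,w)).$$ With $\|P-Q\|_{TV}=\sup_A|P(A)-Q(A)|$ over measurable $A$, the semantic security advantage of Eve$_j$ is $$Adv_{ss}(\mathcal C_n,Z_j^n)=\sup_{P_M,\Pi}\Bigl(\sup_{g}P_{M,Z_j^n}(M\in g(Z_j^n))-\max_{\pi\in\Pi}P_M(M\in\pi)\Bigr),$$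 over all laws $P_M$ on $\{1,\dots,L\}$, partitions $\Pi$ of $\{1,\dots,L\}$ and measurable $g:\mathcal Z_j^n\to\Pi$, where $M\sim P_M$ and $Z_j^n$ has law $P_{Z_j^n|X^n(m,\cdot)}$ given $M=m$. **Theorem.** Assume that the information densities $i[X;Y]$ and $i[X;Z_j]$, $j=1,\dots,d$, exist and have finite moment generating functions at some positive point: for each of them there is $t>0$ with $\mathbb E[e^{t\,i[X;Y]}]<\infty$, respectively $\mathbb E[e^{t\,i[X;Z_j]}]<\infty$, the expectation being under the joint law. Let $R_s\ge0$ satisfy $R_s<I[X;Y]-\max_jI[X;Z_j]$. Then for every randomness rate $R_1$ with $\max_jI[X;Z_j]<R_1<I[X;Y]-R_s$ there exist $\xi_1,\dots,\xi_d>0$ and $\lambda_1,\lambda_2>0$ such that for all sufficiently large $n$ the following holds. Put $L=\lceil e^{nR_s}\rceil$, $L_1=\lceil e^{nR_1}\rceil$ and draw the codewords $X^n(m,w)$ independently from $Q_X^{n}$. Then, with probability at least $1-e^{-n\lambda_1}$, the codebook $\mathcal C_n$ satisfies all of the following: 1. $\|P_{Z_j^n|X^n(m,\cdot)}-Q_{Z_j}^n\|_{TV}\le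 e^{-n\xi_j}$ for all $j=1,\dots,d$ and all messages $m$ (distinguishing security); 2. there is a measurable decoder $D_n$ with $P_{\mathcal E}(\mathcal C_n,D_n)\le e^{-n\lambda_2}$ (reliability); 3. consequently $Adv_{ss}(\mathcal C_n,Z_j^n)\le2e^{-n\xi_j}$ for all $j=1,\dots,d$ (semantic security). -/

import Mathlib

open MeasureTheory ProbabilityTheory InformationTheory
open scoped ENNReal

namespace RISWiretap

/-! ### The RIS-assisted wiretap channel -/

/-- A RIS-assisted wiretap channel with eavesdroppers `Eve_0, …, Eve_{d-1}`. A channel input is a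
pair `(x₁, x₂) ∈ X × X` (direct link, RIS-assisted link). Each link to Bob has its own Markov
kernel from `X` to `Y`, and only the second one depends on the RIS configuration; Eve `j` observes
an output in `Z j` through an arbitrary Markov kernel of the pair. -/
structure RISWiretapChannel (Θ X Y : Type*) {d : ℕ} (Z : Fin d → Type*)
    [MeasurableSpace X] [MeasurableSpace Y] [∀ j, MeasurableSpace (Z j)] where
  directBob : Kernel X Y
  risBob : Θ → Kernel X Y
  eve : Θ → (j : Fin d) → Kernel (X × X) (Z j)
  markov_directBob : IsMarkovKernel directBob
  markov_risBob : ∀ θ, IsMarkovKernel (risBob θ)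
  markov_eve : ∀ θ j, IsMarkovKernel (eve θ j)
  /-- the configuration of the RIS -/
  config : Θ

namespace RISWiretapChannel

variable {Θ X Y : Type*} {d : ℕ} {Z : Fin d → Type*}
  [MeasurableSpace X] [MeasurableSpace Y] [∀ j, MeasurableSpace (Z j)]

/-- Bob's channel `K_AB`, the product kernel
`K_AB(A₁ × A₂, (x₁, x₂)) = K_{AB,1}(A₁, x₁) * K_{AB,2}(A₂, x₂)`. -/
noncomputable def bobKernel (T : RISWiretapChannel Θ X Y Z) : Kernel (X × X) (Y × Y) :=
  T.directBob ∥ₖ T.risBob T.config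

/-- The channel `K_{AE_j}` of Eve `j`. -/
def eveKernel (T : RISWiretapChannel Θ X Y Z) (j : Fin d) : Kernel (X × X) (Z j) :=
  T.eve T.config j

instance (T : RISWiretapChannel Θ X Y Z) : IsMarkovKernel T.bobKernel := by
  have := T.markov_directBob
  have := T.markov_risBob T.config
  unfold bobKernel
  infer_instance

instance (T : RISWiretapChannel Θ X Y Z) (j : Fin d) : IsMarkovKernel (T.eveKernel j) :=
  T.markov_eve T.config j

theorem bobKernel_prod (T : RISWiretapChannel Θ X Y Z) (x : X × X) (A₁ A₂ : Set Y) :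
    T.bobKernel x (A₁ ×ˢ A₂) = T.directBob x.1 A₁ * T.risBob T.config x.2 A₂ := by
  have := T.markov_directBob
  have := T.markov_risBob T.config
  rw [bobKernel, Kernel.parallelComp_apply, Measure.prod_prod]

end RISWiretapChannel

/-! ### Information density and mutual information -/

section Information

variable {A B : Type*} [MeasurableSpace A] [MeasurableSpace B]

/-- The output distribution `Q_B(F) = ∫ K(F, a) Q(da)`. -/
noncomputable def outputDist (K : Kernel A B) (Q : Measure A) : Measure B := Q.bind K

/-- The joint distribution of the input and the output of the channel `K` with input law `Q`. -/
noncomputable def jointDist (K : Kernel A B) (Q : Measure A) : Measure (A × B) := Q ⊗ₘ K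

/-- The Radon-Nikodym derivatives `dK(·, a)/dQ_B` exist for `Q`-almost every `a` and have a version
which is measurable in the pair `(a, b)`. -/
def HasInfoDensity (K : Kernel A B) (Q : Measure A) : Prop :=
  ∃ f : A × B → ℝ≥0∞, Measurable f ∧
    ∀ᵐ a ∂Q, K a = (outputDist K Q).withDensity (fun b => f (a, b))

/-- The information density `i[a; b] = log (dK(·, a)/dQ_B)(b)`. The derivative is taken in its
jointly measurable version, the derivative of the joint law with respect to the product of the
marginals; see `rnDeriv_jointDist_ae_eq`. -/
noncomputable def infoDensity (K : Kernel A B) (Q : Measure A) (p : A × B) : ℝ :=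
  Real.log ((jointDist K Q).rnDeriv (Q.prod (outputDist K Q)) p).toReal

instance (K : Kernel A B) [IsMarkovKernel K] (Q : Measure A) [IsProbabilityMeasure Q] :
    IsProbabilityMeasure (outputDist K Q) := by
  unfold outputDist
  infer_instance

theorem rnDeriv_jointDist_ae_eq (K : Kernel A B) [IsMarkovKernel K] (Q : Measure A)
    [IsProbabilityMeasure Q] (h : HasInfoDensity K Q) :
    ∀ᵐ a ∂Q, ∀ᵐ b ∂(outputDist K Q),
      (jointDist K Q).rnDeriv (Q.prod (outputDist K Q)) (a, b)
        = (K a).rnDeriv (outputDist K Q) b := by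
  obtain ⟨f, hf, hK⟩ := h
  have hjoint : jointDist K Q = (Q.prod (outputDist K Q)).withDensity f := by
    ext s hs
    rw [jointDist, Measure.compProd_apply hs, withDensity_apply _ hs, ← lintegral_indicator hs,
      lintegral_prod _ (hf.indicator hs).aemeasurable]
    refine lintegral_congr_ae ?_
    filter_upwards [hK] with a ha
    rw [ha, withDensity_apply _ (measurable_prodMk_left hs),
      ← lintegral_indicator (measurable_prodMk_left hs)]
    rfl
  have h1 : ∀ᵐ p ∂(Q.prod (outputDist K Q)),
      (jointDist K Q).rnDeriv (Q.prod (outputDist K Q)) p = f p := by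
    rw [hjoint]
    exact Measure.rnDeriv_withDensity _ hf
  filter_upwards [Measure.ae_ae_of_ae_prod h1, hK] with a ha haK
  have h2 : (K a).rnDeriv (outputDist K Q) =ᵐ[outputDist K Q] fun b => f (a, b) := by
    conv_lhs => rw [haK]
    exact Measure.rnDeriv_withDensity _ (hf.comp measurable_prodMk_left)
  filter_upwards [ha, h2] with b hb hb2
  rw [hb, hb2]

/-- When the output σ-algebra is countably generated, the jointly measurable version exists as soon
as `K(·, a) ≪ Q_B` for `Q`-almost every `a`. -/
theorem hasInfoDensity_of_ae_ac [MeasurableSpace.CountablyGenerated B] (K : Kernel A B)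
    [IsMarkovKernel K] (Q : Measure A) [IsProbabilityMeasure Q]
    (h : ∀ᵐ a ∂Q, K a ≪ outputDist K Q) : HasInfoDensity K Q := by
  refine ⟨fun p => Kernel.rnDeriv K (Kernel.const A (outputDist K Q)) p.1 p.2,
    Kernel.measurable_rnDeriv _ _, ?_⟩
  filter_upwards [h] with a ha
  have h1 := Kernel.rnDeriv_eq_rnDeriv_measure (κ := K)
    (η := Kernel.const A (outputDist K Q)) (a := a)
  rw [Kernel.const_apply] at h1
  rw [withDensity_congr_ae h1, Measure.withDensity_rnDeriv_eq _ _ ha]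

/-- The mutual information (in nats): the Kullback-Leibler divergence of the joint law from the
product of the marginals. It takes the value `∞` where the divergence is infinite. -/
noncomputable def mutualInfo (K : Kernel A B) (Q : Measure A) : ℝ≥0∞ :=
  klDiv (jointDist K Q) (Q.prod (outputDist K Q))

end Information

/-! ### Codes and their performance -/

/-- The total variation distance `sup_F |μ F - ν F|` over the measurable sets `F`. -/
noncomputable def tvDist {B : Type*} [MeasurableSpace B] (μ ν : Measure B) : ℝ :=
  ⨆ F : {F : Set B // MeasurableSet F}, |μ.real F - ν.real F|

section Codes

variable {A B : Type*} [MeasurableSpace A] [MeasurableSpace B] {n L L₁ : ℕ}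

/-- A codebook of block length `n` for `L` messages and `L₁` values of the encoder's randomness:
the codeword of `(m, w)` is `C m w`. -/
abbrev Codebook (A : Type*) (n L L₁ : ℕ) : Type _ := Fin L → Fin L₁ → Fin n → A

/-- The law of the random codebook whose codewords are independent with law `Q^n`. -/
noncomputable def codebookLaw (Q : Measure A) (n L L₁ : ℕ) : Measure (Codebook A n L L₁) :=
  Measure.pi fun _ => Measure.pi fun _ => Measure.pi fun _ => Q

/-- The `n`-fold product channel `K^{⊗n}(·, x^n)`. -/
noncomputable def nFold (K : Kernel A B) (x : Fin n → A) : Measure (Fin n → B) :=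
  Measure.pi fun i => K (x i)

/-- The output law given the message `m`, for uniformly distributed randomness of the encoder. -/
noncomputable def outputGivenMessage (K : Kernel A B) (C : Codebook A n L L₁) (m : Fin L) :
    Measure (Fin n → B) :=
  (L₁ : ℝ≥0∞)⁻¹ • ∑ w : Fin L₁, nFold K (C m w)

/-- The output law given the message, as a kernel from messages to output sequences. -/
noncomputable def messageKernel (K : Kernel A B) (C : Codebook A n L L₁) :
    Kernel (Fin L) (Fin n → B) :=
  Kernel.ofFunOfCountable (outputGivenMessage K C)

instance (K : Kernel A B) [IsMarkovKernel K] (C : Codebook A n L L₁) [NeZero L₁] :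
    IsMarkovKernel (messageKernel K C) := by
  refine ⟨fun m => ⟨?_⟩⟩
  have h : ∀ w, nFold K (C m w) Set.univ = 1 := fun w => by
    unfold nFold
    exact measure_univ
  change (outputGivenMessage K C m) Set.univ = 1
  simp only [outputGivenMessage, Measure.smul_apply, Measure.coe_finsetSum, Finset.sum_apply, h,
    Finset.sum_const, Finset.card_univ, Fintype.card_fin, nsmul_eq_mul, mul_one, smul_eq_mul]
  exact ENNReal.inv_mul_cancel (by exact_mod_cast NeZero.ne L₁) (ENNReal.natCast_ne_top _)

/-- Eve's maximal advantage under semantic security,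
`max_{P_M, Π} (sup_g P_{M,Z^n}(M ∈ g(Z^n)) - max_{π ∈ Π} P_M(M ∈ π))`, where `P_M` runs over the
laws on the message set, `Π` over its partitions and `g` over the measurable maps from the output
sequences to `Π`. -/
noncomputable def advSS (K : Kernel A B) (C : Codebook A n L L₁) : ℝ :=
  ⨆ q : ProbabilityMeasure (Fin L) × Finpartition (Finset.univ : Finset (Fin L)),
    (⨆ g : {g : (Fin n → B) → q.2.parts // ∀ π, MeasurableSet (g ⁻¹' {π})},
        ((q.1 : Measure (Fin L)) ⊗ₘ messageKernel K C).real {p | p.1 ∈ (g.1 p.2).1})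
      - ⨆ π : q.2.parts, (q.1 : Measure (Fin L)).real {m | m ∈ π.1}

/-- The average decoding error probability of the codebook `C` and the decoder `D`. -/
noncomputable def avgError (K : Kernel A B) (C : Codebook A n L L₁)
    (D : (Fin n → B) → Fin L) : ℝ :=
  ((L : ℝ) * L₁)⁻¹ * ∑ w : Fin L₁, ∑ m : Fin L, (nFold K (C m w)).real {y | D y ≠ m}

end Codes

end RISWiretap

/-!
# Semantic security over the RIS-assisted wiretap channel

Write each channel as `K(·, a) = F(a, ·) β`, with `β` the output law and `F` a jointly measurable
density of mass one for every input. The density of the `n`-fold channel is then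
`F_n(x, y) = ∏ F(x_i, y_i)`, and the information density of the block is `log F_n`. Since
`E[e^{-i}] = ∫ F F⁻¹ ≤ 1`, the moment generating function of the information density `i` is finite
on `[-1, t]`; its derivative at zero is the mutual information `I`, so both tails of `log F_n`
at `n γ` are exponentially small, the upper one for `γ > I` and the lower one for `γ < I`
(`exists_upper_tail_le`, `exists_lower_tail_le`).

*Security.* The total variation distance between the output law of the code and the ideal output law
is at most the `L¹` deviation `∫ |L₁⁻¹ ∑_w F_n(x(w), ·) - 1| dβⁿ`. Cutting `F_n` at the level
`e^{nγ}`, with `γ` between `I` and the randomness rate, its mean is at most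
`√(e^{nγ} / L₁) + 2 P(F_n > e^{nγ})`: the lower part has a small variance, the upper part a small
mean (`integral_outputDeviation_le`). Exchanging one codeword changes the deviation by at most
`2 / L₁`, so by McDiarmid's inequality the deviation exceeds a slightly larger exponentially small
bound only with doubly exponentially small probability (`exists_resolvability_exponent`). This is
what allows a union bound over the exponentially many messages, whatever the message rate.

*Reliability.* The decoder looks for a message with a codeword of density above `e^{nγ}`, where `γ`
lies between the total rate and `I(X; Y)`. The true codeword falls below this threshold with
exponentially small probability, and a codeword independent of the output exceeds it with
probability at most `e^{-nγ}` (`exists_reliability_exponent`).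

*Semantic security.* An adversary facing an output law that does not depend on the message cannot
beat the best blind guess, and passing to such a law costs at most the total variation distance
(`advSS_le_of_tvDist_le`).

The total variation distance is a supremum over uncountably many events, so the set of good
codebooks is cut out by the deviation and by the union bound of the decoder instead, both measurable
functions of the codebook.
-/

namespace RISWiretap

open scoped NNReal

/-! ### Concentration and integration on finite product spaces -/

theorem lintegral_pi_prod_eq_prod {ι A : Type*} [Fintype ι] [MeasurableSpace A] (μ : Measure A)
    [IsProbabilityMeasure μ] {g : ι → A → ℝ≥0∞} (hg : ∀ i, Measurable (g i)) :
    ∫⁻ x, ∏ i, g i (x i) ∂(Measure.pi fun _ : ι => μ) = ∏ i, ∫⁻ a, g i a ∂μ := by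
  have h := lintegral_prod_eq_prod_lintegral_of_indepFun (μ := Measure.pi fun _ : ι => μ)
    Finset.univ (fun i (x : ι → A) => g i (x i))
    (iIndepFun_pi fun i => (hg i).aemeasurable)
    (fun i => (hg i).comp (measurable_pi_apply i))
  rw [h]
  refine Finset.prod_congr rfl fun i _ => ?_
  exact (measurePreserving_eval (fun _ : ι => μ) i).lintegral_comp (hg i)

/-- Exponential moment form of McDiarmid's inequality: each coordinate of a function with bounded
differences contributes a Hoeffding factor. -/
theorem integral_exp_le_of_bounded_differences {A : Type*} [MeasurableSpace A] (μ : Measure A)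
    [IsProbabilityMeasure μ] {B c : ℝ} (hc : 0 ≤ c) (s : ℝ) :
    ∀ (M : ℕ) (f : (Fin M → A) → ℝ), Measurable f → (∀ x, |f x| ≤ B) →
      (∀ x i a, |f (Function.update x i a) - f x| ≤ c) →
      ∫ x, Real.exp (s * (f x - ∫ y, f y ∂(Measure.pi fun _ => μ))) ∂(Measure.pi fun _ => μ)
        ≤ Real.exp (M * c ^ 2 * s ^ 2 / 2) := by
  intro M
  induction M with
  | zero =>
    intro f hf _ _
    have h : ∀ x y : Fin 0 → A, f x = f y := fun x y => by rw [Subsingleton.elim x y]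
    have h2 : ∀ x, Real.exp (s * (f x - ∫ y, f y ∂(Measure.pi fun _ => μ))) = 1 := fun x => by
      rw [integral_congr_ae (Filter.Eventually.of_forall fun y => h y x)]; simp
    rw [integral_congr_ae (Filter.Eventually.of_forall h2)]
    simp
  | succ M ih =>
    intro f hf hB hfc
    have hBound : ∀ {Ω : Type _} [MeasurableSpace Ω] (P : Measure Ω) [IsProbabilityMeasure P]
        (φ : Ω → ℝ) (_ : Measurable φ) (D : ℝ) (_ : ∀ x, |φ x| ≤ D), Integrable φ P :=
      fun P _ φ hφ D hD => Integrable.of_bound hφ.aestronglyMeasurable D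
        (Filter.Eventually.of_forall fun x => by simpa using hD x)
    set π : Measure (Fin M → A) := Measure.pi fun _ => μ
    set F : A → (Fin M → A) → ℝ := fun a x => f (Fin.insertNth 0 a x)
    have mp := (measurePreserving_piFinSuccAbove (fun _ : Fin (M + 1) => μ) 0).symm
    have hF : Measurable (fun p : A × (Fin M → A) => F p.1 p.2) :=
      hf.comp (MeasurableEquiv.piFinSuccAbove (fun _ : Fin (M + 1) => A) 0).symm.measurable
    have hint : ∀ φ : (Fin (M + 1) → A) → ℝ, Measurable φ → ∀ D, (∀ x, |φ x| ≤ D) →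
        ∫ x, φ x ∂(Measure.pi fun _ => μ)
          = ∫ a, ∫ x, φ (Fin.insertNth 0 a x) ∂π ∂μ := by
      intro φ hφ D hD
      rw [← mp.integral_comp' φ, integral_prod]
      · rfl
      · exact hBound _ _ (hφ.comp (MeasurableEquiv.measurable _)) D fun x => hD _
    set h : A → ℝ := fun a => ∫ x, F a x ∂π
    have hhm : Measurable h := hF.stronglyMeasurable.integral_prod_right.measurable
    have hFa : ∀ a, Measurable (F a) := fun a => hF.comp measurable_prodMk_left
    have hFi : ∀ a, Integrable (F a) π := fun a => hBound π _ (hFa a) B fun x => hB _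
    have hB0 : ∀ φ : (Fin M → A) → ℝ, ∀ D, (∀ x, |φ x| ≤ D) → |∫ x, φ x ∂π| ≤ D := by
      intro φ D hD
      have := norm_integral_le_of_norm_le_const (μ := π) (f := φ) (C := D)
        (Filter.Eventually.of_forall fun x => by simpa using hD x)
      simpa using this
    have hEf : ∫ y, f y ∂(Measure.pi fun _ => μ) = ∫ a, h a ∂μ := hint f hf B hB
    have hhB : ∀ a, |h a| ≤ B := fun a => hB0 _ _ fun x => hB _
    have hhc : ∀ a a', |h a - h a'| ≤ c := by
      intro a a'
      rw [← integral_sub (hFi a) (hFi a')]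
      refine hB0 _ _ fun x => ?_
      have := hfc (Fin.insertNth 0 a' x) 0 a
      rwa [Fin.update_insertNth] at this
    set E := ∫ a, h a ∂μ
    have hEB : |E| ≤ B := by
      have := norm_integral_le_of_norm_le_const (μ := μ) (f := h) (C := B)
        (Filter.Eventually.of_forall fun x => by simpa using hhB x)
      simpa using this
    rw [hEf]
    have expB : ∀ u v : ℝ, |u| ≤ B → |v| ≤ B →
        |Real.exp (s * (u - v))| ≤ Real.exp (|s| * (2 * B)) := by
      intro u v hu hv
      rw [abs_of_pos (Real.exp_pos _)]
      refine Real.exp_le_exp.2 ((le_abs_self _).trans ?_)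
      rw [abs_mul]
      refine mul_le_mul_of_nonneg_left ?_ (abs_nonneg s)
      exact (abs_sub u v).trans (by linarith)
    rw [hint (fun x => Real.exp (s * (f x - E))) (by fun_prop) _ fun x => expB _ _ (hB x) hEB]
    have step : ∀ a, ∫ x, Real.exp (s * (f (Fin.insertNth 0 a x) - E)) ∂π
        ≤ Real.exp (s * (h a - E)) * Real.exp (M * c ^ 2 * s ^ 2 / 2) := by
      intro a
      have h1 := ih (F a) (hFa a) (fun x => hB _) (fun x i b => by
        have := hfc (Fin.insertNth 0 a x) (Fin.succ i) b
        have e : Function.update (Fin.insertNth 0 a x : Fin (M + 1) → A) i.succ b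
            = Fin.insertNth 0 a (Function.update x i b) := by
          simp
        rwa [e] at this)
      have h2 : ∀ x, Real.exp (s * (f (Fin.insertNth 0 a x) - E))
          = Real.exp (s * (h a - E)) * Real.exp (s * (F a x - h a)) := by
        intro x; rw [← Real.exp_add]; congr 1; simp only [F]; ring
      simp_rw [h2]
      rw [integral_const_mul]
      exact mul_le_mul_of_nonneg_left h1 (Real.exp_pos _).le
    have hmeas2 : Measurable fun a => Real.exp (s * (h a - E)) := by fun_prop
    have hoeff : ∫ a, Real.exp (s * (h a - E)) ∂μ ≤ Real.exp (c ^ 2 * s ^ 2 / 2) := by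
      obtain ⟨a₀⟩ : Nonempty A := nonempty_of_isProbabilityMeasure μ
      have := (hasSubgaussianMGF_of_mem_Icc (μ := μ) (a := h a₀ - c) (b := h a₀ + c)
        hhm.aemeasurable (Filter.Eventually.of_forall fun a => by
          have := abs_le.1 (hhc a a₀)
          exact ⟨by linarith [this.1], by linarith [this.2]⟩)).mgf_le s
      have e : h a₀ + c - (h a₀ - c) = 2 * c := by ring
      simp only [mgf, e] at this
      refine this.trans (le_of_eq ?_)
      congr 1
      simp [abs_of_nonneg hc]
    calc ∫ a, ∫ x, Real.exp (s * (f (Fin.insertNth 0 a x) - E)) ∂π ∂μ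
        ≤ ∫ a, Real.exp (s * (h a - E)) * Real.exp (M * c ^ 2 * s ^ 2 / 2) ∂μ := by
          refine integral_mono_of_nonneg
            (Filter.Eventually.of_forall fun a => integral_nonneg fun x => (Real.exp_pos _).le) ?_
            (Filter.Eventually.of_forall step)
          exact (hBound μ _ hmeas2 _ fun a => expB _ _ (hhB a) hEB).mul_const _
      _ = (∫ a, Real.exp (s * (h a - E)) ∂μ) * Real.exp (M * c ^ 2 * s ^ 2 / 2) :=
          integral_mul_const _ _
      _ ≤ Real.exp (c ^ 2 * s ^ 2 / 2) * Real.exp (M * c ^ 2 * s ^ 2 / 2) :=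
          mul_le_mul_of_nonneg_right hoeff (Real.exp_pos _).le
      _ = Real.exp ((M + 1 : ℕ) * c ^ 2 * s ^ 2 / 2) := by
          rw [← Real.exp_add]; congr 1; push_cast; ring

/-- McDiarmid's inequality for identically distributed coordinates, without the optimal constant. -/
theorem measure_ge_le_of_bounded_differences {A : Type*} [MeasurableSpace A] (μ : Measure A)
    [IsProbabilityMeasure μ] {B c t : ℝ} (hc : 0 < c) (ht : 0 ≤ t) {M : ℕ} (hM : 0 < M)
    {f : (Fin M → A) → ℝ} (hf : Measurable f) (hB : ∀ x, |f x| ≤ B)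
    (hfc : ∀ x i a, |f (Function.update x i a) - f x| ≤ c) :
    (Measure.pi fun _ => μ).real {x | ∫ y, f y ∂(Measure.pi fun _ => μ) + t ≤ f x}
      ≤ Real.exp (-(t ^ 2 / (2 * M * c ^ 2))) := by
  have hM' : (0 : ℝ) < M := by exact_mod_cast hM
  set E := ∫ y, f y ∂(Measure.pi fun _ : Fin M => μ)
  -- the minimizer of `-s t + M c² s² / 2`
  set s := t / (M * c ^ 2) with hs
  have hs0 : 0 ≤ s := by positivity
  have hi : Integrable (fun x => Real.exp (s * (f x - E))) (Measure.pi fun _ : Fin M => μ) := by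
    refine Integrable.of_bound (by fun_prop) (Real.exp (s * (B - E)))
      (Filter.Eventually.of_forall fun x => ?_)
    rw [Real.norm_eq_abs, abs_of_pos (Real.exp_pos _)]
    have := (abs_le.1 (hB x)).2
    gcongr
  have h1 := measure_ge_le_exp_mul_mgf t hs0 hi
  have h2 := integral_exp_le_of_bounded_differences μ hc.le s M f hf hB hfc
  have e : {x | E + t ≤ f x} = {x | t ≤ f x - E} := by ext x; simp [le_sub_iff_add_le']
  rw [e]
  refine h1.trans ((mul_le_mul_of_nonneg_left h2 (Real.exp_pos _).le).trans (le_of_eq ?_))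
  rw [← Real.exp_add]
  congr 1
  rw [hs]
  field_simp
  ring

/-! ### Soft covering -/

/-- `F` is a jointly measurable density of a Markov kernel from `(A, α)` to `B` with respect to its
output law `β`: it has mass one in `b` for each `a`, and, as `β` is the output law, mass one in `a`
for almost every `b`. -/
structure IsChannelDensity {A B : Type*} [MeasurableSpace A] [MeasurableSpace B]
    (α : Measure A) (β : Measure B) (F : A × B → ℝ≥0) : Prop where
  measurable : Measurable F
  lintegral_right : ∀ a, ∫⁻ b, F (a, b) ∂β = 1
  lintegral_left : ∀ᵐ b ∂β, ∫⁻ a, F (a, b) ∂α = 1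

section SoftCovering

variable {A B : Type*} [MeasurableSpace A] [MeasurableSpace B] {α : Measure A} {β : Measure B}

theorem integral_abs_sub_integral_le_sqrt_variance [IsProbabilityMeasure α] {X : A → ℝ}
    (hX : MemLp X 2 α) : ∫ a, |X a - ∫ x, X x ∂α| ∂α ≤ √Var[X; α] := by
  refine Real.le_sqrt_of_sq_le ?_
  have hY : MemLp (fun a => |X a - ∫ x, X x ∂α|) 2 α := (hX.sub (memLp_const _)).abs
  have h := variance_nonneg (fun a => |X a - ∫ x, X x ∂α|) α
  rw [variance_eq_sub hY] at h
  rw [variance_eq_integral hX.aestronglyMeasurable.aemeasurable]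
  simp only [Pi.pow_apply, sq_abs] at h
  linarith

/-- Mean deviation of an empirical average of a nonnegative function of mean one. The part of `g`
below the level `c` is treated by its variance, the part above by its mean. -/
theorem integral_abs_average_sub_one_le [IsProbabilityMeasure α] {g : A → ℝ≥0} (hg : Measurable g)
    (h1 : ∫⁻ a, g a ∂α = 1) (c : ℝ≥0) {M : ℕ} (hM : 0 < M) :
    ∫ C, |(M : ℝ)⁻¹ * ∑ w, (g (C w) : ℝ) - 1| ∂(Measure.pi fun _ : Fin M => α)
      ≤ √(c / M) + 2 * ∫ a, ({a | c < g a}.indicator (fun a => (g a : ℝ)) a) ∂α := by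
  have hM' : (0 : ℝ) < M := by exact_mod_cast hM
  set π := Measure.pi fun _ : Fin M => α
  have hS : MeasurableSet {a | c < g a} := measurableSet_lt measurable_const hg
  have hgr : Measurable fun a => (g a : ℝ) := hg.coe_nnreal_real
  have hgi : Integrable (fun a => (g a : ℝ)) α := by
    refine ⟨hgr.aestronglyMeasurable, ?_⟩
    simp [HasFiniteIntegral, h1]
  have hg1 : ∫ a, (g a : ℝ) ∂α = 1 := by
    rw [integral_eq_lintegral_of_nonneg_ae
      (Filter.Eventually.of_forall fun a => NNReal.coe_nonneg _)
      hgr.aestronglyMeasurable]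
    simp [h1]
  set g₁ : A → ℝ := {a | c < g a}ᶜ.indicator fun a => (g a : ℝ) with hg₁
  set g₂ : A → ℝ := {a | c < g a}.indicator fun a => (g a : ℝ) with hg₂
  have hadd : ∀ a, (g a : ℝ) = g₁ a + g₂ a := fun a =>
    (congrFun (Set.indicator_compl_add_self {a | c < g a} fun a => (g a : ℝ)) a).symm
  have hg₁i : Integrable g₁ α := hgi.indicator hS.compl
  have hg₂i : Integrable g₂ α := hgi.indicator hS
  have hg₂0 : ∀ a, 0 ≤ g₂ a := fun a => Set.indicator_nonneg (fun _ _ => NNReal.coe_nonneg _) a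
  have hg₁0 : ∀ a, 0 ≤ g₁ a := fun a => Set.indicator_nonneg (fun _ _ => NNReal.coe_nonneg _) a
  have hg₁c : ∀ a, g₁ a ≤ c := fun a => by
    rw [hg₁, Set.indicator_apply]
    split_ifs with h
    · exact_mod_cast not_lt.1 (show ¬ c < g a from h)
    · exact c.coe_nonneg
  have hm : ∫ a, g₁ a ∂α + ∫ a, g₂ a ∂α = 1 := by
    rw [← integral_add hg₁i hg₂i, ← hg1]
    exact integral_congr_ae (Filter.Eventually.of_forall fun a => (hadd a).symm)
  have hg₁L : MemLp g₁ 2 α := MemLp.of_bound hg₁i.aestronglyMeasurable c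
    (Filter.Eventually.of_forall fun a => by
      rw [Real.norm_eq_abs, abs_of_nonneg (hg₁0 a)]; exact hg₁c a)
  have hev : ∀ (w : Fin M) {φ : A → ℝ}, Integrable φ α → Integrable (fun C => φ (C w)) π ∧
      ∫ C, φ (C w) ∂π = ∫ a, φ a ∂α := fun w φ hφ => by
    have mp := measurePreserving_eval (fun _ : Fin M => α) w
    refine ⟨(mp.integrable_comp hφ.aestronglyMeasurable).2 hφ, ?_⟩
    have h2 : AEStronglyMeasurable φ (Measure.map (Function.eval w) π) := by
      rw [mp.map_eq]; exact hφ.aestronglyMeasurable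
    have := integral_map mp.aemeasurable h2
    rw [mp.map_eq] at this
    exact this.symm
  have havg : ∀ {φ : A → ℝ}, Integrable φ α →
      Integrable (fun C => (M : ℝ)⁻¹ * ∑ w, φ (C w)) π ∧
      ∫ C, (M : ℝ)⁻¹ * ∑ w, φ (C w) ∂π = ∫ a, φ a ∂α := fun {φ} hφ => by
    refine ⟨(integrable_finsetSum _ fun w _ => (hev w hφ).1).const_mul _, ?_⟩
    rw [integral_const_mul, integral_finsetSum _ fun w _ => (hev w hφ).1]
    simp only [(hev _ hφ).2, Finset.sum_const, Finset.card_univ, Fintype.card_fin, nsmul_eq_mul]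
    field_simp
  set X : (Fin M → A) → ℝ := fun C => (M : ℝ)⁻¹ * ∑ w, g₁ (C w) with hX
  have hXL : MemLp X 2 π := by
    have h : ∀ w : Fin M, MemLp (fun C : Fin M → A => g₁ (C w)) 2 π := fun w =>
      hg₁L.comp_measurePreserving (measurePreserving_eval (fun _ : Fin M => α) w)
    exact (memLp_finsetSum (f := fun w (C : Fin M → A) => g₁ (C w)) Finset.univ
      fun w _ => h w).const_mul _
  have hvar : Var[X; π] ≤ c / M := by
    have e1 : Var[fun C : Fin M → A => ∑ w, g₁ (C w); π] = M * Var[g₁; α] := by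
      have := variance_sum_pi (μ := fun _ : Fin M => α) (X := fun _ => g₁) fun _ => hg₁L
      simp only [Finset.sum_const, Finset.card_univ, Fintype.card_fin, nsmul_eq_mul] at this
      rw [← this]
      congr 1
      ext C
      simp
    have e2 : Var[g₁; α] ≤ c := by
      refine (variance_le_expectation_sq hg₁i.aestronglyMeasurable).trans ?_
      have : ∫ a, (g₁ ^ 2) a ∂α ≤ ∫ a, c * (g a : ℝ) ∂α := by
        refine integral_mono_of_nonneg (Filter.Eventually.of_forall fun a => sq_nonneg _)
          (hgi.const_mul _) (Filter.Eventually.of_forall fun a => ?_)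
        simp only [Pi.pow_apply, sq]
        refine mul_le_mul (hg₁c a) ?_ (hg₁0 a) c.coe_nonneg
        rw [hadd a]; linarith [hg₂0 a]
      rw [integral_const_mul, hg1, mul_one] at this
      exact this
    rw [hX, variance_const_mul, e1]
    calc ((M : ℝ)⁻¹) ^ 2 * (M * Var[g₁; α]) = Var[g₁; α] / M := by field_simp
      _ ≤ c / M := by gcongr
  have hXm : ∫ C, X C ∂π = ∫ a, g₁ a ∂α := (havg hg₁i).2
  have hdev := (integral_abs_sub_integral_le_sqrt_variance hXL).trans (Real.sqrt_le_sqrt hvar)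
  rw [hXm] at hdev
  have hi1 : Integrable (fun C => |X C - ∫ a, g₁ a ∂α|) π :=
    ((havg hg₁i).1.sub (integrable_const _)).abs
  have hi2 := (havg hg₂i).1
  have hi12 : Integrable
      (fun C => |X C - ∫ a, g₁ a ∂α| + (M : ℝ)⁻¹ * ∑ w, g₂ (C w)) π := hi1.add hi2
  have key : ∀ C : Fin M → A, |(M : ℝ)⁻¹ * ∑ w, (g (C w) : ℝ) - 1|
      ≤ |X C - ∫ a, g₁ a ∂α| + (M : ℝ)⁻¹ * ∑ w, g₂ (C w) + ∫ a, g₂ a ∂α := by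
    intro C
    have e : (M : ℝ)⁻¹ * ∑ w, (g (C w) : ℝ) - 1 = (X C - ∫ a, g₁ a ∂α)
        + (M : ℝ)⁻¹ * ∑ w, g₂ (C w) - ∫ a, g₂ a ∂α := by
      simp only [hX, hadd, Finset.sum_add_distrib, mul_add]
      linarith
    have p1 : 0 ≤ (M : ℝ)⁻¹ * ∑ w, g₂ (C w) :=
      mul_nonneg (by positivity) (Finset.sum_nonneg fun w _ => hg₂0 _)
    have p2 : 0 ≤ ∫ a, g₂ a ∂α := integral_nonneg hg₂0
    rw [e]
    refine (abs_sub _ _).trans ?_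
    rw [abs_of_nonneg p2]
    refine add_le_add ((abs_add_le _ _).trans ?_) le_rfl
    rw [abs_of_nonneg p1]
  calc ∫ C, |(M : ℝ)⁻¹ * ∑ w, (g (C w) : ℝ) - 1| ∂π
      ≤ ∫ C, (|X C - ∫ a, g₁ a ∂α| + (M : ℝ)⁻¹ * ∑ w, g₂ (C w) + ∫ a, g₂ a ∂α) ∂π :=
        integral_mono_of_nonneg (Filter.Eventually.of_forall fun C => abs_nonneg _)
          (hi12.add (integrable_const _)) (Filter.Eventually.of_forall key)
    _ = ∫ C, |X C - ∫ a, g₁ a ∂α| ∂π + ∫ a, g₂ a ∂α + ∫ a, g₂ a ∂α := by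
        rw [integral_add hi12 (integrable_const _), integral_add hi1 hi2, (havg hg₂i).2]
        simp
    _ ≤ _ := by linarith

/-- The `L¹` distance between the output density of the code `C` and the output density one of the
ideal output law `β`. -/
noncomputable def outputDeviation (β : Measure B) (F : A × B → ℝ≥0) {M : ℕ} (C : Fin M → A) : ℝ :=
  ∫ b, |(M : ℝ)⁻¹ * ∑ w, (F (C w, b) : ℝ) - 1| ∂β

theorem outputDeviation_nonneg {A B : Type*} [MeasurableSpace B] (β : Measure B)
    (F : A × B → ℝ≥0) {M : ℕ} (C : Fin M → A) : 0 ≤ outputDeviation β F C :=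
  integral_nonneg fun _ => abs_nonneg _

namespace IsChannelDensity

variable {F : A × B → ℝ≥0}

theorem measurable_right (hF : IsChannelDensity α β F) (a : A) : Measurable fun b => F (a, b) :=
  hF.measurable.comp measurable_prodMk_left

theorem integrable_right (hF : IsChannelDensity α β F) (a : A) :
    Integrable (fun b => (F (a, b) : ℝ)) β := by
  refine ⟨(hF.measurable_right a).coe_nnreal_real.aestronglyMeasurable, ?_⟩
  simp [HasFiniteIntegral, hF.lintegral_right a]

theorem integral_right (hF : IsChannelDensity α β F) (a : A) : ∫ b, (F (a, b) : ℝ) ∂β = 1 := by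
  rw [integral_eq_lintegral_of_nonneg_ae (Filter.Eventually.of_forall fun b => NNReal.coe_nonneg _)
    (hF.measurable_right a).coe_nnreal_real.aestronglyMeasurable]
  simp [hF.lintegral_right a]

theorem integrable_average (hF : IsChannelDensity α β F) [IsProbabilityMeasure β] {M : ℕ}
    (C : Fin M → A) :
    Integrable (fun b => (M : ℝ)⁻¹ * ∑ w, (F (C w, b) : ℝ) - 1) β :=
  ((integrable_finsetSum _ fun w _ => hF.integrable_right (C w)).const_mul _).sub
    (integrable_const _)

theorem measurable_average (hF : IsChannelDensity α β F) {M : ℕ} :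
    Measurable fun p : (Fin M → A) × B => (M : ℝ)⁻¹ * ∑ w, (F (p.1 w, p.2) : ℝ) - 1 := by
  have h : ∀ w, Measurable fun p : (Fin M → A) × B => (F (p.1 w, p.2) : ℝ) := fun w =>
    (hF.measurable.comp (((measurable_pi_apply w).comp measurable_fst).prodMk
      measurable_snd)).coe_nnreal_real
  fun_prop

theorem measurable_outputDeviation (hF : IsChannelDensity α β F) [IsProbabilityMeasure β] {M : ℕ} :
    Measurable fun C : Fin M → A => outputDeviation β F C := by
  have h := hF.measurable_average (M := M)
  have h2 : Measurable fun p : (Fin M → A) × B =>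
      |(M : ℝ)⁻¹ * ∑ w, (F (p.1 w, p.2) : ℝ) - 1| := by
    simpa only [Real.norm_eq_abs] using h.norm
  exact h2.stronglyMeasurable.integral_prod_right.measurable

theorem outputDeviation_le_two (hF : IsChannelDensity α β F) [IsProbabilityMeasure β] {M : ℕ}
    (hM : 0 < M) (C : Fin M → A) :
    outputDeviation β F C ≤ 2 := by
  have hM' : (0 : ℝ) < M := by exact_mod_cast hM
  have hi : Integrable (fun b => (M : ℝ)⁻¹ * ∑ w, (F (C w, b) : ℝ)) β :=
    (integrable_finsetSum _ fun w _ => hF.integrable_right (C w)).const_mul _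
  calc outputDeviation β F C
      ≤ ∫ b, ((M : ℝ)⁻¹ * ∑ w, (F (C w, b) : ℝ) + 1) ∂β := by
        refine integral_mono_of_nonneg (Filter.Eventually.of_forall fun _ => abs_nonneg _)
          (hi.add (integrable_const _)) (Filter.Eventually.of_forall fun b => ?_)
        refine (abs_sub _ _).trans ?_
        rw [abs_one, abs_of_nonneg]
        positivity
    _ = 2 := by
        rw [integral_add hi (integrable_const _), integral_const_mul,
          integral_finsetSum _ fun w _ => hF.integrable_right (C w)]
        simp only [hF.integral_right, Finset.sum_const, Finset.card_univ, Fintype.card_fin,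
          nsmul_eq_mul, mul_one, integral_const, probReal_univ, smul_eq_mul]
        rw [inv_mul_cancel₀ hM'.ne']
        norm_num

theorem abs_outputDeviation_update_sub_le (hF : IsChannelDensity α β F) [IsProbabilityMeasure β]
    {M : ℕ} (C : Fin M → A) (w : Fin M) (a : A) :
    |outputDeviation β F (Function.update C w a) - outputDeviation β F C| ≤ 2 / M := by
  have hi := fun C : Fin M → A => (hF.integrable_average C).abs
  unfold outputDeviation
  rw [← integral_sub (hi _) (hi _)]
  refine (abs_integral_le_integral_abs).trans ?_
  have hsum : ∀ b, ∑ v, (F (Function.update C w a v, b) : ℝ)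
      = ∑ v, (F (C v, b) : ℝ) + (F (a, b) - F (C w, b)) := by
    intro b
    rw [← Finset.add_sum_erase _ _ (Finset.mem_univ w),
      ← Finset.add_sum_erase _ (fun v => (F (C v, b) : ℝ)) (Finset.mem_univ w)]
    have : ∑ v ∈ Finset.univ.erase w, (F (Function.update C w a v, b) : ℝ)
        = ∑ v ∈ Finset.univ.erase w, (F (C v, b) : ℝ) :=
      Finset.sum_congr rfl fun v hv => by
        rw [Function.update_of_ne (Finset.ne_of_mem_erase hv)]
    rw [this, Function.update_self]
    ring
  calc _ ≤ ∫ b, (M : ℝ)⁻¹ * ((F (a, b) : ℝ) + F (C w, b)) ∂β := by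
        refine integral_mono_of_nonneg (Filter.Eventually.of_forall fun _ => abs_nonneg _)
          (((hF.integrable_right a).add (hF.integrable_right _)).const_mul _)
          (Filter.Eventually.of_forall fun b => ?_)
        refine (abs_abs_sub_abs_le_abs_sub _ _).trans ?_
        rw [hsum]
        have e : (M : ℝ)⁻¹ * (∑ v, (F (C v, b) : ℝ) + (F (a, b) - F (C w, b))) - 1
            - ((M : ℝ)⁻¹ * ∑ v, (F (C v, b) : ℝ) - 1)
            = (M : ℝ)⁻¹ * (F (a, b) - F (C w, b)) := by ring
        rw [e, abs_mul, abs_of_nonneg (by positivity : (0 : ℝ) ≤ (M : ℝ)⁻¹)]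
        refine mul_le_mul_of_nonneg_left ((abs_sub _ _).trans ?_) (by positivity)
        rw [NNReal.abs_eq, NNReal.abs_eq]
    _ = 2 / M := by
        rw [integral_const_mul, integral_add (hF.integrable_right a) (hF.integrable_right _),
          hF.integral_right, hF.integral_right]
        ring

/-- Soft covering in expectation: `M` random codewords approximate the output law as soon as `M` is
large compared with a level `c` that the density rarely exceeds. -/
theorem integral_outputDeviation_le (hF : IsChannelDensity α β F) [IsProbabilityMeasure α]
    [IsProbabilityMeasure β] {c : ℝ≥0} {M : ℕ} (hM : 0 < M) {δ : ℝ} (hδ : 0 ≤ δ)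
    (htail : ∫⁻ a, ∫⁻ b, ({p | c < F p}.indicator (fun p => (F p : ℝ≥0∞)) (a, b)) ∂β ∂α
      ≤ ENNReal.ofReal δ) :
    ∫ C, outputDeviation β F C ∂(Measure.pi fun _ : Fin M => α) ≤ √(c / M) + 2 * δ := by
  set π := Measure.pi fun _ : Fin M => α
  have hS : MeasurableSet {p | c < F p} := measurableSet_lt measurable_const hF.measurable
  have hFt : Measurable ({p | c < F p}.indicator fun p => (F p : ℝ≥0∞)) :=
    hF.measurable.coe_nnreal_ennreal.indicator hS
  have hdi : Integrable (fun C => outputDeviation β F C) π :=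
    Integrable.of_bound hF.measurable_outputDeviation.aestronglyMeasurable 2
      (Filter.Eventually.of_forall fun C => by
        rw [Real.norm_eq_abs, abs_of_nonneg (outputDeviation_nonneg β F C)]
        exact hF.outputDeviation_le_two hM C)
  have hm : Measurable fun p : (Fin M → A) × B =>
      ‖(M : ℝ)⁻¹ * ∑ w, (F (p.1 w, p.2) : ℝ) - 1‖ₑ := hF.measurable_average.enorm
  have hle : ENNReal.ofReal (∫ C, outputDeviation β F C ∂π)
      ≤ ENNReal.ofReal (√(c / M) + 2 * δ) := by
    calc ENNReal.ofReal (∫ C, outputDeviation β F C ∂π)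
        = ∫⁻ C, ∫⁻ b, ‖(M : ℝ)⁻¹ * ∑ w, (F (C w, b) : ℝ) - 1‖ₑ ∂β ∂π := by
          rw [ofReal_integral_eq_lintegral_ofReal hdi
            (Filter.Eventually.of_forall (outputDeviation_nonneg β F))]
          refine lintegral_congr fun C => ?_
          exact ofReal_integral_norm_eq_lintegral_enorm (hF.integrable_average C)
      _ = ∫⁻ b, ∫⁻ C, ‖(M : ℝ)⁻¹ * ∑ w, (F (C w, b) : ℝ) - 1‖ₑ ∂π ∂β :=
          lintegral_lintegral_swap hm.aemeasurable
      _ ≤ ∫⁻ b, (ENNReal.ofReal √(c / M) + 2 * ∫⁻ a,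
            ({p | c < F p}.indicator (fun p => (F p : ℝ≥0∞)) (a, b)) ∂α) ∂β := by
          refine lintegral_mono_ae ?_
          filter_upwards [hF.lintegral_left] with b hb
          have hg : Measurable fun a => F (a, b) := hF.measurable.comp measurable_prodMk_right
          have hgr : ∀ w : Fin M, Integrable (fun C : Fin M → A => (F (C w, b) : ℝ)) π := by
            intro w
            have h0 : Integrable (fun a => (F (a, b) : ℝ)) α := by
              refine ⟨hg.coe_nnreal_real.aestronglyMeasurable, ?_⟩
              simp [HasFiniteIntegral, hb]
            exact ((measurePreserving_eval (fun _ : Fin M => α) w).integrable_comp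
              h0.aestronglyMeasurable).2 h0
          have hi : Integrable (fun C : Fin M → A => (M : ℝ)⁻¹ * ∑ w, (F (C w, b) : ℝ) - 1) π :=
            ((integrable_finsetSum _ fun w _ => hgr w).const_mul _).sub (integrable_const _)
          rw [← ofReal_integral_norm_eq_lintegral_enorm hi]
          refine (ENNReal.ofReal_le_ofReal
            (integral_abs_average_sub_one_le hg hb c hM)).trans ?_
          rw [ENNReal.ofReal_add (Real.sqrt_nonneg _) (mul_nonneg zero_le_two
            (integral_nonneg fun a => Set.indicator_nonneg (fun _ _ => NNReal.coe_nonneg _) a)),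
            ENNReal.ofReal_mul zero_le_two]
          have hSb : MeasurableSet {a | c < F (a, b)} := measurableSet_lt measurable_const hg
          have e : ENNReal.ofReal (∫ a, {a | c < F (a, b)}.indicator
              (fun a => (F (a, b) : ℝ)) a ∂α)
              = ∫⁻ a, ({p | c < F p}.indicator (fun p => (F p : ℝ≥0∞)) (a, b)) ∂α := by
            rw [ofReal_integral_eq_lintegral_ofReal]
            · refine lintegral_congr fun a => ?_
              by_cases h : c < F (a, b) <;> simp [h]
            · refine Integrable.indicator ⟨hg.coe_nnreal_real.aestronglyMeasurable, ?_⟩ hSb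
              simp [HasFiniteIntegral, hb]
            · exact Filter.Eventually.of_forall fun a =>
                Set.indicator_nonneg (fun _ _ => NNReal.coe_nonneg _) a
          rw [e]
          simp
      _ = ENNReal.ofReal √(c / M) + 2 * ∫⁻ a, ∫⁻ b,
            ({p | c < F p}.indicator (fun p => (F p : ℝ≥0∞)) (a, b)) ∂β ∂α := by
          rw [lintegral_add_left measurable_const, lintegral_const_mul]
          · rw [lintegral_lintegral_swap (f := fun a b =>
              {p | c < F p}.indicator (fun p => (F p : ℝ≥0∞)) (a, b)) hFt.aemeasurable]
            simp
          · exact Measurable.lintegral_prod_left' hFt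
      _ ≤ ENNReal.ofReal √(c / M) + 2 * ENNReal.ofReal δ := by gcongr
      _ = ENNReal.ofReal (√(c / M) + 2 * δ) := by
          rw [ENNReal.ofReal_add (Real.sqrt_nonneg _) (by positivity),
            ENNReal.ofReal_mul zero_le_two]
          simp
  exact (ENNReal.ofReal_le_ofReal_iff (by positivity)).1 hle

/-- Concentration of the deviation around its mean. The exponent is linear in the number of
codewords, so that the bound is doubly exponential in the block length. -/
theorem measure_outputDeviation_ge_le (hF : IsChannelDensity α β F) [IsProbabilityMeasure α]
    [IsProbabilityMeasure β] {M : ℕ} (hM : 0 < M) {t : ℝ} (ht : 0 ≤ t) :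
    (Measure.pi fun _ : Fin M => α).real
      {C | ∫ C', outputDeviation β F C' ∂(Measure.pi fun _ : Fin M => α) + t
        ≤ outputDeviation β F C} ≤ Real.exp (-(t ^ 2 * M / 8)) := by
  have hM' : (0 : ℝ) < M := by exact_mod_cast hM
  refine (measure_ge_le_of_bounded_differences α (c := 2 / M) (B := 2) (by positivity) ht hM
    hF.measurable_outputDeviation (fun C => ?_)
    fun C w a => hF.abs_outputDeviation_update_sub_le C w a).trans (le_of_eq ?_)
  · rw [abs_of_nonneg (outputDeviation_nonneg β F C)]
    exact hF.outputDeviation_le_two hM C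
  · congr 1
    field_simp
    ring

end IsChannelDensity

end SoftCovering

/-! ### Random coding -/

section RandomCoding

variable {A B : Type*} [MeasurableSpace A] [MeasurableSpace B] {α : Measure A} {β : Measure B}
  {L L₁ : ℕ}

/-- The threshold decoder: some message one of whose codewords has density above `c` at the received
output can be chosen measurably. -/
theorem exists_measurable_thresholdDecoder [NeZero L] {F : A × B → ℝ≥0} (hF : Measurable F)
    (c : ℝ≥0) (C : Fin L → Fin L₁ → A) :
    ∃ D : B → Fin L, Measurable D ∧
      ∀ b, (∃ m w, c < F (C m w, b)) → ∃ w, c < F (C (D b) w, b) := by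
  classical
  -- the decoder depends on `b` only through a pattern in a finite discrete space
  let pattern : B → Fin L → Bool := fun b m => decide (∃ w, c < F (C m w, b))
  let pick : (Fin L → Bool) → Fin L := fun p => if h : ∃ m, p m = true then h.choose else 0
  have hpattern : Measurable pattern := by
    refine measurable_pi_iff.2 fun m => measurable_to_bool ?_
    have : (fun b => pattern b m) ⁻¹' {true} = ⋃ w, {b | c < F (C m w, b)} := by
      ext b; simp [pattern]
    rw [this]
    exact MeasurableSet.iUnion fun w =>
      measurableSet_lt measurable_const (hF.comp measurable_prodMk_left)
  refine ⟨fun b => pick (pattern b), (measurable_of_countable pick).comp hpattern, ?_⟩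
  rintro b ⟨m, hm⟩
  have h : ∃ m, pattern b m = true := ⟨m, decide_eq_true hm⟩
  have h2 := h.choose_spec
  have e : pick (pattern b) = h.choose := dif_pos h
  change ∃ w, c < F (C (pick (pattern b)) w, b)
  rw [e]
  exact of_decide_eq_true h2

/-- The union bound for the average error of the threshold decoder at level `c`: the sent codeword
is below the threshold, or a codeword of another message is above it. -/
noncomputable def thresholdErrorBound (β : Measure B) (F : A × B → ℝ≥0) (c : ℝ≥0)
    (C : Fin L → Fin L₁ → A) : ℝ≥0∞ :=
  ((L : ℝ≥0∞) * L₁)⁻¹ * ∑ m, ∑ w,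
    (∫⁻ b, {p | F p ≤ c}.indicator (fun p => (F p : ℝ≥0∞)) (C m w, b) ∂β
      + ∑ m' ∈ Finset.univ.erase m, ∑ w',
          ∫⁻ b, {p | c < F p}.indicator 1 (C m' w', b) * (F (C m w, b) : ℝ≥0∞) ∂β)

theorem average_error_le_thresholdErrorBound {F : A × B → ℝ≥0} (hF : Measurable F) {c : ℝ≥0}
    {C : Fin L → Fin L₁ → A} {D : B → Fin L} (hDm : Measurable D)
    (hD : ∀ b, (∃ m w, c < F (C m w, b)) → ∃ w, c < F (C (D b) w, b)) :
    ((L : ℝ≥0∞) * L₁)⁻¹ * ∑ m, ∑ w, (β.withDensity fun b => F (C m w, b)) {b | D b ≠ m}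
      ≤ thresholdErrorBound β F c C := by
  classical
  refine mul_le_mul_right (Finset.sum_le_sum fun m _ => Finset.sum_le_sum fun w _ => ?_) _
  have hFm : ∀ m w, Measurable fun b => F (C m w, b) := fun m w => hF.comp measurable_prodMk_left
  have hS : MeasurableSet {b | D b ≠ m} := (hDm (measurableSet_singleton m)).compl
  have hu : Measurable ({p | c < F p}.indicator (1 : A × B → ℝ≥0∞)) :=
    measurable_one.indicator (measurableSet_lt measurable_const hF)
  have hum : ∀ m' w', Measurable fun b =>
      {p | c < F p}.indicator (1 : A × B → ℝ≥0∞) (C m' w', b) * (F (C m w, b) : ℝ≥0∞) :=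
    fun m' w' => (hu.comp measurable_prodMk_left).mul (hFm m w).coe_nnreal_ennreal
  have hl : Measurable fun b => {p | F p ≤ c}.indicator (fun p => (F p : ℝ≥0∞)) (C m w, b) :=
    (hF.coe_nnreal_ennreal.indicator (measurableSet_le hF measurable_const)).comp
      measurable_prodMk_left
  have hsum : ∑ m' ∈ Finset.univ.erase m, ∑ w',
      ∫⁻ b, {p | c < F p}.indicator (1 : A × B → ℝ≥0∞) (C m' w', b) * (F (C m w, b) : ℝ≥0∞) ∂β
      = ∫⁻ b, ∑ m' ∈ Finset.univ.erase m, ∑ w',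
        {p | c < F p}.indicator (1 : A × B → ℝ≥0∞) (C m' w', b) * (F (C m w, b) : ℝ≥0∞) ∂β := by
    rw [lintegral_finsetSum _ fun m' _ => Finset.measurable_sum _ fun w' _ => hum m' w']
    exact Finset.sum_congr rfl fun m' _ => (lintegral_finsetSum _ fun w' _ => hum m' w').symm
  rw [withDensity_apply _ hS, ← lintegral_indicator hS, hsum, ← lintegral_add_left hl]
  refine lintegral_mono fun b => ?_
  by_cases hb : D b = m
  · simp [hb]
  by_cases hc : F (C m w, b) ≤ c
  · simp [hb, hc]
  obtain ⟨w', hw'⟩ := hD b ⟨m, w, not_le.1 hc⟩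
  refine le_add_left ?_
  rw [Set.indicator_of_mem (show b ∈ {b | D b ≠ m} from hb)]
  calc (F (C m w, b) : ℝ≥0∞)
      = {p | c < F p}.indicator (1 : A × B → ℝ≥0∞) (C (D b) w', b) * (F (C m w, b) : ℝ≥0∞) := by
        rw [Set.indicator_of_mem (show (C (D b) w', b) ∈ {p | c < F p} from hw')]; simp
    _ ≤ ∑ w', {p | c < F p}.indicator (1 : A × B → ℝ≥0∞) (C (D b) w', b)
          * (F (C m w, b) : ℝ≥0∞) :=
        Finset.single_le_sum (f := fun w' => {p | c < F p}.indicator (1 : A × B → ℝ≥0∞)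
          (C (D b) w', b) * (F (C m w, b) : ℝ≥0∞)) (fun _ _ => zero_le) (Finset.mem_univ w')
    _ ≤ _ := Finset.single_le_sum (f := fun m' => ∑ w', {p | c < F p}.indicator
          (1 : A × B → ℝ≥0∞) (C m' w', b) * (F (C m w, b) : ℝ≥0∞)) (fun _ _ => zero_le)
          (Finset.mem_erase.2 ⟨hb, Finset.mem_univ _⟩)

section Codebook

variable [IsProbabilityMeasure α]

theorem measurePreserving_codeword (m : Fin L) (w : Fin L₁) :
    MeasurePreserving (fun C : Fin L → Fin L₁ → A => C m w)
      (Measure.pi fun _ => Measure.pi fun _ => α) α :=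
  (measurePreserving_eval (fun _ : Fin L₁ => α) w).comp
    (measurePreserving_eval (fun _ : Fin L => Measure.pi fun _ : Fin L₁ => α) m)

theorem lintegral_codeword_mul_codeword {m m' : Fin L} (hm : m' ≠ m) (w w' : Fin L₁)
    {φ ψ : A → ℝ≥0∞} (hφ : Measurable φ) (hψ : Measurable ψ) :
    ∫⁻ C : Fin L → Fin L₁ → A, φ (C m' w') * ψ (C m w)
      ∂(Measure.pi fun _ => Measure.pi fun _ => α) = (∫⁻ a, φ a ∂α) * ∫⁻ a, ψ a ∂α := by
  have hi : iIndepFun (fun (i : Fin L) (C : Fin L → Fin L₁ → A) => id (C i))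
      (Measure.pi fun _ => Measure.pi fun _ => α) := iIndepFun_pi fun _ => aemeasurable_id
  have h2 := (hi.indepFun hm).comp (hφ.comp (measurable_pi_apply w'))
    (hψ.comp (measurable_pi_apply w))
  have h3 := lintegral_mul_eq_lintegral_mul_lintegral_of_indepFun
    (hφ.comp (measurePreserving_codeword (α := α) m' w').measurable)
    (hψ.comp (measurePreserving_codeword (α := α) m w).measurable) h2
  rw [← (measurePreserving_codeword (α := α) m' w').lintegral_comp hφ,
    ← (measurePreserving_codeword (α := α) m w).lintegral_comp hψ]
  exact h3

end Codebook

theorem measurable_thresholdErrorBound [IsProbabilityMeasure β] {F : A × B → ℝ≥0}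
    (hF : Measurable F) (c : ℝ≥0) :
    Measurable fun C : Fin L → Fin L₁ → A => thresholdErrorBound β F c C := by
  have hcw : ∀ m w, Measurable fun p : (Fin L → Fin L₁ → A) × B => (p.1 m w, p.2) := fun m w =>
    ((measurable_pi_apply w).comp ((measurable_pi_apply m).comp measurable_fst)).prodMk
      measurable_snd
  have hl : Measurable ({p | F p ≤ c}.indicator fun p => (F p : ℝ≥0∞)) :=
    hF.coe_nnreal_ennreal.indicator (measurableSet_le hF measurable_const)
  have hu : Measurable ({p | c < F p}.indicator (1 : A × B → ℝ≥0∞)) :=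
    measurable_one.indicator (measurableSet_lt measurable_const hF)
  unfold thresholdErrorBound
  refine Measurable.const_mul (Finset.measurable_sum _ fun m _ =>
    Finset.measurable_sum _ fun w _ => Measurable.add ?_ (Finset.measurable_sum _ fun m' _ =>
      Finset.measurable_sum _ fun w' _ => ?_)) _
  · exact (hl.comp (hcw m w)).lintegral_prod_right'
  · exact ((hu.comp (hcw m' w')).mul
      (hF.comp (hcw m w)).coe_nnreal_ennreal).lintegral_prod_right'

/-- The random coding bound. A codeword of another message is independent of the output, hence
exceeds the threshold `c` with probability at most `c⁻¹`. -/
theorem IsChannelDensity.lintegral_thresholdErrorBound_le [IsProbabilityMeasure α]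
    [IsProbabilityMeasure β] {F : A × B → ℝ≥0} (hF : IsChannelDensity α β F) {c : ℝ≥0} (hc : 0 < c)
    (hL : 0 < L) (hL₁ : 0 < L₁) :
    ∫⁻ C : Fin L → Fin L₁ → A, thresholdErrorBound β F c C
        ∂(Measure.pi fun _ => Measure.pi fun _ => α)
      ≤ ∫⁻ a, ∫⁻ b, {p | F p ≤ c}.indicator (fun p => (F p : ℝ≥0∞)) (a, b) ∂β ∂α
        + (L * L₁ : ℝ≥0∞) * (c : ℝ≥0∞)⁻¹ := by
  classical
  have hcw : ∀ m w, Measurable fun p : (Fin L → Fin L₁ → A) × B => (p.1 m w, p.2) := fun m w =>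
    ((measurable_pi_apply w).comp ((measurable_pi_apply m).comp measurable_fst)).prodMk
      measurable_snd
  have hl : Measurable ({p | F p ≤ c}.indicator fun p => (F p : ℝ≥0∞)) :=
    hF.measurable.coe_nnreal_ennreal.indicator (measurableSet_le hF.measurable measurable_const)
  have hu : Measurable ({p | c < F p}.indicator (1 : A × B → ℝ≥0∞)) :=
    measurable_one.indicator (measurableSet_lt measurable_const hF.measurable)
  have hm1 : ∀ m w, Measurable fun C : Fin L → Fin L₁ → A =>
      ∫⁻ b, {p | F p ≤ c}.indicator (fun p => (F p : ℝ≥0∞)) (C m w, b) ∂β := fun m w =>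
    (hl.comp (hcw m w)).lintegral_prod_right'
  have hm2' : ∀ m w m' w', Measurable fun p : (Fin L → Fin L₁ → A) × B =>
      {p | c < F p}.indicator (1 : A × B → ℝ≥0∞) (p.1 m' w', p.2)
        * (F (p.1 m w, p.2) : ℝ≥0∞) := fun m w m' w' =>
    (hu.comp (hcw m' w')).mul (hF.measurable.comp (hcw m w)).coe_nnreal_ennreal
  have hm2 : ∀ m w m' w', Measurable fun C : Fin L → Fin L₁ → A =>
      ∫⁻ b, {p | c < F p}.indicator (1 : A × B → ℝ≥0∞) (C m' w', b)
        * (F (C m w, b) : ℝ≥0∞) ∂β := fun m w m' w' => (hm2' m w m' w').lintegral_prod_right'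
  have hm12 : ∀ m w, Measurable fun C : Fin L → Fin L₁ → A =>
      ∫⁻ b, {p | F p ≤ c}.indicator (fun p => (F p : ℝ≥0∞)) (C m w, b) ∂β
      + ∑ m' ∈ Finset.univ.erase m, ∑ w',
          ∫⁻ b, {p | c < F p}.indicator 1 (C m' w', b) * (F (C m w, b) : ℝ≥0∞) ∂β := fun m w =>
    (hm1 m w).add (Finset.measurable_sum _ fun m' _ => Finset.measurable_sum _ fun w' _ =>
      hm2 m w m' w')
  set P : Measure (Fin L → Fin L₁ → A) := Measure.pi fun _ => Measure.pi fun _ => α with hP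
  set T : ℝ≥0∞ := ∫⁻ a, ∫⁻ b, {p | F p ≤ c}.indicator (fun p => (F p : ℝ≥0∞)) (a, b) ∂β ∂α with hT
  have hmiss : ∀ m w, ∫⁻ C, ∫⁻ b, {p | F p ≤ c}.indicator (fun p => (F p : ℝ≥0∞)) (C m w, b) ∂β ∂P
      = T := fun m w =>
    (measurePreserving_codeword (α := α) m w).lintegral_comp
      (f := fun a => ∫⁻ b, {p | F p ≤ c}.indicator (fun p => (F p : ℝ≥0∞)) (a, b) ∂β)
      hl.lintegral_prod_right'
  have hfalse : ∀ m w m' w', m' ≠ m →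
      ∫⁻ C, ∫⁻ b, {p | c < F p}.indicator (1 : A × B → ℝ≥0∞) (C m' w', b)
        * (F (C m w, b) : ℝ≥0∞) ∂β ∂P ≤ (c : ℝ≥0∞)⁻¹ := by
    intro m w m' w' hne
    rw [lintegral_lintegral_swap (f := fun (C : Fin L → Fin L₁ → A) b =>
      {p | c < F p}.indicator (1 : A × B → ℝ≥0∞) (C m' w', b) * (F (C m w, b) : ℝ≥0∞))
      (hm2' m w m' w').aemeasurable]
    calc ∫⁻ b, ∫⁻ C, {p | c < F p}.indicator (1 : A × B → ℝ≥0∞) (C m' w', b)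
            * (F (C m w, b) : ℝ≥0∞) ∂P ∂β
        ≤ ∫⁻ _, (c : ℝ≥0∞)⁻¹ ∂β := by
          refine lintegral_mono_ae ?_
          filter_upwards [hF.lintegral_left] with b hb
          have hFb : Measurable fun a => (F (a, b) : ℝ≥0∞) :=
            (hF.measurable.comp measurable_prodMk_right).coe_nnreal_ennreal
          have h := lintegral_codeword_mul_codeword (α := α) hne w w'
            (φ := fun a => {p | c < F p}.indicator (1 : A × B → ℝ≥0∞) (a, b))
            (ψ := fun a => (F (a, b) : ℝ≥0∞)) (hu.comp measurable_prodMk_right) hFb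
          rw [hP, h, hb, mul_one]
          calc ∫⁻ a, {p | c < F p}.indicator (1 : A × B → ℝ≥0∞) (a, b) ∂α
              ≤ ∫⁻ a, (c : ℝ≥0∞)⁻¹ * F (a, b) ∂α := by
                refine lintegral_mono fun a => ?_
                by_cases h : c < F (a, b)
                · rw [Set.indicator_of_mem (show (a, b) ∈ {p | c < F p} from h), Pi.one_apply,
                    ← ENNReal.inv_mul_cancel (by exact_mod_cast hc.ne')
                      (ENNReal.coe_ne_top (r := c))]
                  gcongr
                · simp [h]
            _ = (c : ℝ≥0∞)⁻¹ := by rw [lintegral_const_mul _ hFb, hb, mul_one]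
      _ = (c : ℝ≥0∞)⁻¹ := by simp
  have hL' : (L : ℝ≥0∞) * L₁ ≠ 0 := by simp [hL.ne', hL₁.ne']
  have hLt : (L : ℝ≥0∞) * L₁ ≠ ⊤ := ENNReal.mul_ne_top (by simp) (by simp)
  unfold thresholdErrorBound
  rw [lintegral_const_mul _ (Finset.measurable_sum _ fun m _ => Finset.measurable_sum _ fun w _ =>
    hm12 m w), lintegral_finsetSum _ fun m _ => Finset.measurable_sum _ fun w _ =>
    hm12 m w]
  have hterm : ∀ m, ∫⁻ C, ∑ w,
      (∫⁻ b, {p | F p ≤ c}.indicator (fun p => (F p : ℝ≥0∞)) (C m w, b) ∂β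
      + ∑ m' ∈ Finset.univ.erase m, ∑ w',
          ∫⁻ b, {p | c < F p}.indicator 1 (C m' w', b) * (F (C m w, b) : ℝ≥0∞) ∂β) ∂P
      ≤ L₁ * (T + (L * L₁ : ℝ≥0∞) * (c : ℝ≥0∞)⁻¹) := by
    intro m
    rw [lintegral_finsetSum _ fun w _ =>
      hm12 m w]
    refine (Finset.sum_le_card_nsmul Finset.univ _ (T + (L * L₁ : ℝ≥0∞) * (c : ℝ≥0∞)⁻¹)
      fun w _ => ?_).trans (by simp [mul_add])
    rw [lintegral_add_left (hm1 m w), hmiss,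
      lintegral_finsetSum _ fun m' _ => Finset.measurable_sum _ fun w' _ => hm2 m w m' w']
    gcongr
    have : ∀ m' ∈ Finset.univ.erase m, ∫⁻ C, ∑ w',
        ∫⁻ b, {p | c < F p}.indicator 1 (C m' w', b) * (F (C m w, b) : ℝ≥0∞) ∂β ∂P
        ≤ L₁ * (c : ℝ≥0∞)⁻¹ := by
      intro m' hm'
      rw [lintegral_finsetSum _ fun w' _ => hm2 m w m' w']
      exact (Finset.sum_le_card_nsmul Finset.univ _ _ fun w' _ =>
        hfalse m w m' w' (Finset.ne_of_mem_erase hm')).trans (by simp)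
    refine (Finset.sum_le_card_nsmul _ _ _ this).trans ?_
    rw [nsmul_eq_mul, mul_assoc]
    gcongr
    exact (Finset.card_le_univ _).trans (by simp)
  calc ((L : ℝ≥0∞) * L₁)⁻¹ * ∑ m, ∫⁻ C, ∑ w,
      (∫⁻ b, {p | F p ≤ c}.indicator (fun p => (F p : ℝ≥0∞)) (C m w, b) ∂β
      + ∑ m' ∈ Finset.univ.erase m, ∑ w',
          ∫⁻ b, {p | c < F p}.indicator 1 (C m' w', b) * (F (C m w, b) : ℝ≥0∞) ∂β) ∂P
      ≤ ((L : ℝ≥0∞) * L₁)⁻¹ * ((L * L₁) * (T + (L * L₁ : ℝ≥0∞) * (c : ℝ≥0∞)⁻¹)) := by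
        gcongr
        refine (Finset.sum_le_card_nsmul Finset.univ _ _ fun m _ => hterm m).trans ?_
        simp [mul_assoc]
    _ = T + (L * L₁ : ℝ≥0∞) * (c : ℝ≥0∞)⁻¹ := by
        rw [← mul_assoc, ENNReal.inv_mul_cancel hL' hLt, one_mul]

end RandomCoding

/-! ### Densities of channels -/

section Density

variable {A B : Type*} [MeasurableSpace A] [MeasurableSpace B]

theorem jointDist_eq_withDensity {K : Kernel A B} [IsMarkovKernel K] {Q : Measure A}
    [IsProbabilityMeasure Q] {f : A × B → ℝ≥0∞} (hf : Measurable f)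
    (hK : ∀ᵐ a ∂Q, K a = (outputDist K Q).withDensity fun b => f (a, b)) :
    jointDist K Q = (Q.prod (outputDist K Q)).withDensity f := by
  ext s hs
  rw [jointDist, Measure.compProd_apply hs, withDensity_apply _ hs, ← lintegral_indicator hs,
    lintegral_prod _ (hf.indicator hs).aemeasurable]
  refine lintegral_congr_ae ?_
  filter_upwards [hK] with a ha
  rw [ha, withDensity_apply _ (measurable_prodMk_left hs),
    ← lintegral_indicator (measurable_prodMk_left hs)]
  rfl

/-- The density of a channel can be chosen finite and of mass one for every input: on the null set
of inputs where this fails it is replaced by the constant one. -/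
theorem HasInfoDensity.exists_isChannelDensity {K : Kernel A B} [IsMarkovKernel K] {Q : Measure A}
    [IsProbabilityMeasure Q] (h : HasInfoDensity K Q) :
    ∃ F : A × B → ℝ≥0, IsChannelDensity Q (outputDist K Q) F ∧
      ∀ᵐ a ∂Q, K a = (outputDist K Q).withDensity fun b => (F (a, b) : ℝ≥0∞) := by
  classical
  obtain ⟨f, hf, hK⟩ := h
  set ν := outputDist K Q
  let G : A × B → ℝ≥0 := fun p => (f p).toNNReal
  have hG : Measurable G := hf.ennreal_toNNReal
  have hGe : Measurable fun p => (G p : ℝ≥0∞) := hG.coe_nnreal_ennreal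
  let S : Set A := {a | ∫⁻ b, G (a, b) ∂ν = 1}
  have hS : MeasurableSet S := hGe.lintegral_prod_right' (measurableSet_singleton 1)
  let F : A × B → ℝ≥0 := fun p => if p.1 ∈ S then G p else 1
  have hF : Measurable F := Measurable.ite (measurable_fst hS) hG measurable_const
  have hKG : ∀ᵐ a ∂Q, a ∈ S ∧ K a = ν.withDensity fun b => (G (a, b) : ℝ≥0∞) := by
    filter_upwards [hK] with a ha
    have hfa : Measurable fun b => f (a, b) := hf.comp measurable_prodMk_left
    have h1 : ∫⁻ b, f (a, b) ∂ν = 1 := by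
      have : K a Set.univ = 1 := measure_univ
      rwa [ha, withDensity_apply _ MeasurableSet.univ, setLIntegral_univ] at this
    have h2 : (fun b => (G (a, b) : ℝ≥0∞)) =ᵐ[ν] fun b => f (a, b) := by
      filter_upwards [ae_lt_top hfa (by rw [h1]; exact ENNReal.one_ne_top)] with b hb
      exact ENNReal.coe_toNNReal hb.ne
    refine ⟨?_, ?_⟩
    · change ∫⁻ b, G (a, b) ∂ν = 1
      rw [lintegral_congr_ae h2, h1]
    · rw [ha, withDensity_congr_ae h2]
  have hKF : ∀ᵐ a ∂Q, K a = ν.withDensity fun b => (F (a, b) : ℝ≥0∞) := by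
    filter_upwards [hKG] with a ha
    rw [ha.2]
    simp only [F, ha.1, if_true]
  have hFe : Measurable fun p => (F p : ℝ≥0∞) := hF.coe_nnreal_ennreal
  refine ⟨F, ⟨hF, fun a => ?_, ?_⟩, hKF⟩
  · by_cases ha : a ∈ S
    · have ha' : ∫⁻ b, G (a, b) ∂ν = 1 := ha
      simpa only [F, ha, if_true] using ha'
    · simp [F, ha]
  · refine ae_eq_of_forall_setLIntegral_eq_of_sigmaFinite (f := fun b => ∫⁻ a, F (a, b) ∂Q)
      (g := fun _ => 1) hFe.lintegral_prod_left' measurable_const fun s hs _ => ?_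
    rw [lintegral_lintegral_swap (f := fun b a => (F (a, b) : ℝ≥0∞))
      (hFe.comp measurable_swap).aemeasurable]
    have : ν s = ∫⁻ a, K a s ∂Q := Measure.bind_apply hs K.measurable.aemeasurable
    rw [setLIntegral_one, this]
    refine lintegral_congr_ae ?_
    filter_upwards [hKF] with a ha
    rw [ha, withDensity_apply _ hs]

end Density

/-! ### Memoryless extensions -/

section NFold

variable {A B : Type*} [MeasurableSpace A] [MeasurableSpace B]

/-- The density of the `n`-fold product channel. -/
def nFoldDensity (F : A × B → ℝ≥0) (n : ℕ) (p : (Fin n → A) × (Fin n → B)) : ℝ≥0 :=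
  ∏ i, F (p.1 i, p.2 i)

variable {α : Measure A} {β : Measure B} {F : A × B → ℝ≥0}

theorem IsChannelDensity.nFold [IsProbabilityMeasure α] [IsProbabilityMeasure β]
    (hF : IsChannelDensity α β F) (n : ℕ) :
    IsChannelDensity (Measure.pi fun _ : Fin n => α) (Measure.pi fun _ : Fin n => β)
      (nFoldDensity F n) where
  measurable := Finset.measurable_prod _ fun i _ => hF.measurable.comp
    (((measurable_pi_apply i).comp measurable_fst).prodMk
      ((measurable_pi_apply i).comp measurable_snd))
  lintegral_right x := by
    simp only [nFoldDensity, ENNReal.ofNNReal_finsetProd]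
    rw [lintegral_pi_prod_eq_prod β (g := fun i b => (F (x i, b) : ℝ≥0∞))
      fun i => (hF.measurable_right (x i)).coe_nnreal_ennreal]
    simp [hF.lintegral_right]
  lintegral_left := by
    have h : ∀ i : Fin n, ∀ᵐ y ∂(Measure.pi fun _ : Fin n => β), ∫⁻ a, F (a, y i) ∂α = 1 :=
      fun i => (Measure.tendsto_eval_ae_ae (μ := fun _ : Fin n => β) (i := i)).eventually
        hF.lintegral_left
    filter_upwards [ae_all_iff.2 h] with y hy
    simp only [nFoldDensity, ENNReal.ofNNReal_finsetProd]
    rw [lintegral_pi_prod_eq_prod α (g := fun i a => (F (a, y i) : ℝ≥0∞))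
      fun i => (hF.measurable.comp measurable_prodMk_right).coe_nnreal_ennreal]
    simp [hy]

theorem nFold_eq_withDensity [IsProbabilityMeasure β] {K : Kernel A B} [IsMarkovKernel K]
    (hF : Measurable F) {n : ℕ} {x : Fin n → A}
    (hx : ∀ i, K (x i) = β.withDensity fun b => (F (x i, b) : ℝ≥0∞)) :
    nFold K x = (Measure.pi fun _ => β).withDensity fun y => (nFoldDensity F n (x, y) : ℝ≥0∞) := by
  refine Measure.pi_eq fun s hs => ?_
  have hFx : ∀ i, Measurable fun b => (F (x i, b) : ℝ≥0∞) := fun i =>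
    (hF.comp measurable_prodMk_left).coe_nnreal_ennreal
  have hS := MeasurableSet.univ_pi hs
  rw [withDensity_apply _ hS, ← lintegral_indicator hS]
  have e : ∀ y : Fin n → B, (Set.univ.pi s).indicator
      (fun y => (nFoldDensity F n (x, y) : ℝ≥0∞)) y
      = ∏ i, (s i).indicator (fun b => (F (x i, b) : ℝ≥0∞)) (y i) := by
    intro y
    by_cases hy : ∀ i, y i ∈ s i
    · rw [Set.indicator_of_mem (Set.mem_univ_pi.2 hy)]
      simp [nFoldDensity, hy]
    · rw [Set.indicator_of_notMem (by simpa using hy)]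
      push Not at hy
      obtain ⟨i, hi⟩ := hy
      exact (Finset.prod_eq_zero (Finset.mem_univ i) (Set.indicator_of_notMem hi _)).symm
  simp_rw [e]
  rw [lintegral_pi_prod_eq_prod β fun i => (hFx i).indicator (hs i)]
  refine Finset.prod_congr rfl fun i _ => ?_
  rw [hx i, withDensity_apply _ (hs i), lintegral_indicator (hs i)]

theorem lintegral_nFoldDensity_rpow [IsProbabilityMeasure α] [IsProbabilityMeasure β]
    (hF : Measurable F) {r : ℝ} (hr : 0 ≤ r) (n : ℕ) :
    ∫⁻ x, ∫⁻ y, (nFoldDensity F n (x, y) : ℝ≥0∞) ^ r ∂(Measure.pi fun _ => β)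
        ∂(Measure.pi fun _ => α)
      = (∫⁻ a, ∫⁻ b, (F (a, b) : ℝ≥0∞) ^ r ∂β ∂α) ^ n := by
  have hFr : Measurable fun p => (F p : ℝ≥0∞) ^ r := hF.coe_nnreal_ennreal.pow_const r
  have h : ∀ x : Fin n → A, ∫⁻ y, (nFoldDensity F n (x, y) : ℝ≥0∞) ^ r ∂(Measure.pi fun _ => β)
      = ∏ i, ∫⁻ b, (F (x i, b) : ℝ≥0∞) ^ r ∂β := by
    intro x
    simp only [nFoldDensity, ENNReal.ofNNReal_finsetProd, ← ENNReal.prod_rpow_of_nonneg hr]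
    exact lintegral_pi_prod_eq_prod β (g := fun i b => (F (x i, b) : ℝ≥0∞) ^ r)
      fun i => hFr.comp measurable_prodMk_left
  simp_rw [h]
  rw [lintegral_pi_prod_eq_prod α (g := fun _ a => ∫⁻ b, (F (a, b) : ℝ≥0∞) ^ r ∂β)
    fun i => hFr.lintegral_prod_right']
  simp

end NFold

/-! ### Large deviations of the information density -/

section Chernoff

theorem coe_le_mul_rpow_of_lt {f c : ℝ≥0} {s : ℝ} (hs : 0 ≤ s) (hc : 0 < c) (h : c < f) :
    (f : ℝ≥0∞) ≤ (c : ℝ≥0∞) ^ (-s) * (f : ℝ≥0∞) ^ (1 + s) := by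
  have hf : 0 < f := hc.trans h
  calc (f : ℝ≥0∞) = (f : ℝ≥0∞) ^ (-s) * (f : ℝ≥0∞) ^ (1 + s) := by
        rw [← ENNReal.rpow_add _ _ (by exact_mod_cast hf.ne') ENNReal.coe_ne_top]
        simp
    _ ≤ _ := by
        refine mul_le_mul_left ?_ _
        rw [ENNReal.rpow_neg, ENNReal.rpow_neg]
        refine ENNReal.inv_le_inv.2 (ENNReal.rpow_le_rpow ?_ hs)
        exact_mod_cast h.le

theorem coe_le_mul_rpow_of_le {f c : ℝ≥0} {s : ℝ} (hs : s ≤ 0) (h : f ≤ c) :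
    (f : ℝ≥0∞) ≤ (c : ℝ≥0∞) ^ (-s) * (f : ℝ≥0∞) ^ (1 + s) := by
  rcases eq_or_ne f 0 with rfl | hf
  · simp
  calc (f : ℝ≥0∞) = (f : ℝ≥0∞) ^ (-s) * (f : ℝ≥0∞) ^ (1 + s) := by
        rw [← ENNReal.rpow_add _ _ (by exact_mod_cast hf) ENNReal.coe_ne_top]
        simp
    _ ≤ _ := by
        refine mul_le_mul_left ?_ _
        refine ENNReal.rpow_le_rpow ?_ (by linarith)
        exact_mod_cast h

theorem hasDerivAt_mgf_mul_exp_zero {Ω : Type*} [MeasurableSpace Ω] {P : Measure Ω}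
    [IsProbabilityMeasure P] {X : Ω → ℝ} (h0 : 0 ∈ interior (integrableExpSet X P)) (γ : ℝ) :
    HasDerivAt (fun s => mgf X P s * Real.exp (-(s * γ))) (∫ ω, X ω ∂P - γ) 0 := by
  have h1 := hasDerivAt_mgf h0
  have h2 : HasDerivAt (fun s : ℝ => Real.exp (-(s * γ))) (Real.exp (-(0 * γ)) * (-(1 * γ))) 0 :=
    ((hasDerivAt_id (0 : ℝ)).mul_const γ).neg.exp
  refine (h1.mul h2).congr_deriv ?_
  simp [sub_eq_add_neg]

/-- The function `s ↦ E[exp (s (X - γ))]` is one at zero, with derivative `E[X] - γ < 0` there. -/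
theorem exists_mgf_mul_exp_lt_one_of_integral_lt {Ω : Type*} [MeasurableSpace Ω] {P : Measure Ω}
    [IsProbabilityMeasure P] {X : Ω → ℝ} (h0 : 0 ∈ interior (integrableExpSet X P)) {γ : ℝ}
    (hγ : ∫ ω, X ω ∂P < γ) :
    ∃ s, 0 < s ∧ s ∈ integrableExpSet X P ∧ mgf X P s * Real.exp (-(s * γ)) < 1 := by
  have hd := hasDerivAt_mgf_mul_exp_zero h0 γ
  have h4 := (hasDerivAt_iff_tendsto_slope.1 hd).mono_left
    (nhdsWithin_mono 0 fun s (hs : 0 < s) => ne_of_gt hs)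
  have h5 : ∀ᶠ s in nhdsWithin (0 : ℝ) (Set.Ioi 0),
      slope (fun s => mgf X P s * Real.exp (-(s * γ))) 0 s < 0 :=
    h4.eventually_lt_const (by linarith)
  have h6 : ∀ᶠ s in nhdsWithin (0 : ℝ) (Set.Ioi 0), s ∈ integrableExpSet X P :=
    mem_nhdsWithin_of_mem_nhds (mem_interior_iff_mem_nhds.1 h0)
  obtain ⟨s, hs1, hs2, hs3⟩ := (h5.and (h6.and self_mem_nhdsWithin)).exists
  have hs3 : 0 < s := hs3
  refine ⟨s, hs3, hs2, ?_⟩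
  rw [slope_def_field, div_lt_iff₀ (by linarith)] at hs1
  simp only [mgf_zero, zero_mul, neg_zero, Real.exp_zero, mul_one] at hs1
  linarith

theorem exists_mgf_mul_exp_lt_one_of_lt_integral {Ω : Type*} [MeasurableSpace Ω] {P : Measure Ω}
    [IsProbabilityMeasure P] {X : Ω → ℝ} (h0 : 0 ∈ interior (integrableExpSet X P)) {γ : ℝ}
    (hγ : γ < ∫ ω, X ω ∂P) :
    ∃ s, -1 < s ∧ s < 0 ∧ s ∈ integrableExpSet X P ∧ mgf X P s * Real.exp (-(s * γ)) < 1 := by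
  have hd := hasDerivAt_mgf_mul_exp_zero h0 γ
  have h4 := (hasDerivAt_iff_tendsto_slope.1 hd).mono_left
    (nhdsWithin_mono 0 fun s (hs : s < 0) => ne_of_lt hs)
  have h5 : ∀ᶠ s in nhdsWithin (0 : ℝ) (Set.Iio 0),
      0 < slope (fun s => mgf X P s * Real.exp (-(s * γ))) 0 s :=
    h4.eventually_const_lt (by linarith)
  have h6 : ∀ᶠ s in nhdsWithin (0 : ℝ) (Set.Iio 0), s ∈ integrableExpSet X P :=
    mem_nhdsWithin_of_mem_nhds (mem_interior_iff_mem_nhds.1 h0)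
  have h7 : ∀ᶠ s in nhdsWithin (0 : ℝ) (Set.Iio 0), -1 < s :=
    mem_nhdsWithin_of_mem_nhds (lt_mem_nhds (by norm_num))
  obtain ⟨s, hs1, hs2, hs4, hs3⟩ := (h5.and (h6.and (h7.and self_mem_nhdsWithin))).exists
  have hs3 : s < 0 := hs3
  refine ⟨s, hs4, hs3, hs2, ?_⟩
  rw [slope_def_field, lt_div_iff_of_neg (by linarith)] at hs1
  simp only [mgf_zero, zero_mul, neg_zero, Real.exp_zero, mul_one] at hs1
  linarith

variable {A B : Type*} [MeasurableSpace A] [MeasurableSpace B] {K : Kernel A B} [IsMarkovKernel K]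
  {Q : Measure A} [IsProbabilityMeasure Q] {F : A × B → ℝ≥0}

instance : IsProbabilityMeasure (jointDist K Q) := by
  unfold jointDist
  infer_instance

theorem lintegral_exp_infoDensity (hF : Measurable F)
    (hJ : jointDist K Q = (Q.prod (outputDist K Q)).withDensity fun p => (F p : ℝ≥0∞)) (s : ℝ) :
    ∫⁻ p, ENNReal.ofReal (Real.exp (s * infoDensity K Q p)) ∂(jointDist K Q)
      = ∫⁻ p, (F p : ℝ≥0∞) * (F p : ℝ≥0∞) ^ s ∂(Q.prod (outputDist K Q)) := by
  have hFe := hF.coe_nnreal_ennreal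
  have hac : jointDist K Q ≪ Q.prod (outputDist K Q) := by
    rw [hJ]; exact withDensity_absolutelyContinuous _ _
  have h1 : ∀ᵐ p ∂(jointDist K Q),
      (jointDist K Q).rnDeriv (Q.prod (outputDist K Q)) p = F p := by
    refine hac.ae_le ?_
    conv in (jointDist K Q) => rw [hJ]
    exact Measure.rnDeriv_withDensity _ hFe
  have h2 : ∀ᵐ p ∂(jointDist K Q), F p ≠ 0 := by
    rw [hJ, ae_withDensity_iff hFe]
    exact Filter.Eventually.of_forall fun p hp => by exact_mod_cast hp
  have h3 : ∫⁻ p, ENNReal.ofReal (Real.exp (s * infoDensity K Q p)) ∂(jointDist K Q)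
      = ∫⁻ p, (F p : ℝ≥0∞) ^ s ∂(jointDist K Q) := by
    refine lintegral_congr_ae ?_
    filter_upwards [h1, h2] with p hp1 hp2
    have hpos : (0 : ℝ) < F p := by exact_mod_cast pos_iff_ne_zero.2 hp2
    rw [infoDensity, hp1, ENNReal.coe_toReal, mul_comm, ← Real.rpow_def_of_pos hpos,
      ← ENNReal.ofReal_rpow_of_pos hpos, ENNReal.ofReal_coe_nnreal]
  rw [h3, hJ, lintegral_withDensity_eq_lintegral_mul _ hFe (hFe.pow_const s)]
  rfl

/-- The moment generating function of the information density is always finite at `-1`, so that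
finiteness at a positive point makes zero an interior point of its domain. -/
theorem zero_mem_interior_integrableExpSet_infoDensity (hF : Measurable F)
    (hJ : jointDist K Q = (Q.prod (outputDist K Q)).withDensity fun p => (F p : ℝ≥0∞))
    (hmgf : ∃ t : ℝ, 0 < t ∧
      Integrable (fun p => Real.exp (t * infoDensity K Q p)) (jointDist K Q)) :
    0 ∈ interior (integrableExpSet (infoDensity K Q) (jointDist K Q)) := by
  obtain ⟨t, ht, hti⟩ := hmgf
  have hm : Measurable (infoDensity K Q) :=
    Real.measurable_log.comp (Measure.measurable_rnDeriv _ _).ennreal_toReal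
  have h1 : (-1 : ℝ) ∈ integrableExpSet (infoDensity K Q) (jointDist K Q) := by
    refine ⟨by fun_prop, ?_⟩
    rw [hasFiniteIntegral_iff_ofReal (Filter.Eventually.of_forall fun p => (Real.exp_pos _).le),
      lintegral_exp_infoDensity hF hJ]
    refine (lintegral_mono (g := fun _ => 1) fun p => ?_).trans_lt (by simp)
    rw [ENNReal.rpow_neg_one]
    exact ENNReal.mul_inv_le_one _
  have h2 : Set.Icc (-1) t ⊆ integrableExpSet (infoDensity K Q) (jointDist K Q) :=
    convex_integrableExpSet.ordConnected.out h1 hti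
  exact interior_mono h2 (by rw [interior_Icc]; exact ⟨by norm_num, ht⟩)

theorem toReal_mutualInfo (hac : jointDist K Q ≪ Q.prod (outputDist K Q)) :
    (mutualInfo K Q).toReal = ∫ p, infoDensity K Q p ∂(jointDist K Q) := by
  unfold mutualInfo
  rw [toReal_klDiv_of_measure_eq hac (by simp)]
  rfl

theorem lintegral_rpow_eq_ofReal_mgf (hF : Measurable F)
    (hJ : jointDist K Q = (Q.prod (outputDist K Q)).withDensity fun p => (F p : ℝ≥0∞)) {s : ℝ}
    (hs1 : -1 < s) (hs : s ∈ integrableExpSet (infoDensity K Q) (jointDist K Q)) :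
    ∫⁻ a, ∫⁻ b, (F (a, b) : ℝ≥0∞) ^ (1 + s) ∂(outputDist K Q) ∂Q
      = ENNReal.ofReal (mgf (infoDensity K Q) (jointDist K Q) s) := by
  rw [mgf, ofReal_integral_eq_lintegral_ofReal hs
    (Filter.Eventually.of_forall fun p => (Real.exp_pos _).le), lintegral_exp_infoDensity hF hJ,
    ← lintegral_prod (fun p => (F p : ℝ≥0∞) ^ (1 + s))
      (hF.coe_nnreal_ennreal.pow_const _).aemeasurable]
  refine lintegral_congr fun p => ?_
  rcases eq_or_ne (F p) 0 with h | h
  · simp [h, ENNReal.zero_rpow_of_pos (by linarith : 0 < 1 + s)]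
  · rw [ENNReal.rpow_add _ _ (by exact_mod_cast h) ENNReal.coe_ne_top, ENNReal.rpow_one]

/-- Chernoff's bound for the memoryless extension, on any set `S` where `F_n` is dominated as in
`coe_le_mul_rpow_of_lt` (upper tail, `s > 0`) or `coe_le_mul_rpow_of_le` (lower tail, `s < 0`). -/
theorem lintegral_indicator_nFoldDensity_le (hF : Measurable F)
    (hJ : jointDist K Q = (Q.prod (outputDist K Q)).withDensity fun p => (F p : ℝ≥0∞)) {s γ : ℝ}
    (hs1 : -1 < s) (hs : s ∈ integrableExpSet (infoDensity K Q) (jointDist K Q)) (n : ℕ)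
    (S : Set ((Fin n → A) × (Fin n → B)))
    (hS : ∀ p ∈ S, (nFoldDensity F n p : ℝ≥0∞)
      ≤ ((Real.exp (n * γ)).toNNReal : ℝ≥0∞) ^ (-s) * (nFoldDensity F n p : ℝ≥0∞) ^ (1 + s)) :
    ∫⁻ x, ∫⁻ y, S.indicator (fun p => (nFoldDensity F n p : ℝ≥0∞)) (x, y)
        ∂(Measure.pi fun _ => outputDist K Q) ∂(Measure.pi fun _ => Q)
      ≤ ENNReal.ofReal ((mgf (infoDensity K Q) (jointDist K Q) s * Real.exp (-(s * γ))) ^ n) := by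
  have hFn : Measurable fun p : (Fin n → A) × (Fin n → B) =>
      (nFoldDensity F n p : ℝ≥0∞) ^ (1 + s) :=
    (Measurable.coe_nnreal_ennreal (Finset.measurable_prod _ fun i _ => hF.comp
      (((measurable_pi_apply i).comp measurable_fst).prodMk
        ((measurable_pi_apply i).comp measurable_snd)))).pow_const _
  set c : ℝ≥0∞ := ((Real.exp (n * γ)).toNNReal : ℝ≥0∞) ^ (-s) with hc
  have hce : c = ENNReal.ofReal (Real.exp (-(s * γ)) ^ n) := by
    change ENNReal.ofReal (Real.exp (n * γ)) ^ (-s) = _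
    rw [ENNReal.ofReal_rpow_of_pos (Real.exp_pos _), ← Real.exp_mul, ← Real.exp_nat_mul]
    congr 2
    ring
  calc ∫⁻ x, ∫⁻ y, S.indicator (fun p => (nFoldDensity F n p : ℝ≥0∞)) (x, y)
        ∂(Measure.pi fun _ => outputDist K Q) ∂(Measure.pi fun _ => Q)
      ≤ ∫⁻ x, ∫⁻ y, c * (nFoldDensity F n (x, y) : ℝ≥0∞) ^ (1 + s)
        ∂(Measure.pi fun _ => outputDist K Q) ∂(Measure.pi fun _ => Q) := by
        refine lintegral_mono fun x => lintegral_mono fun y => ?_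
        exact Set.indicator_le' (f := fun p => (nFoldDensity F n p : ℝ≥0∞))
          (g := fun p => c * (nFoldDensity F n p : ℝ≥0∞) ^ (1 + s)) hS (fun _ _ => zero_le) (x, y)
    _ = c * (∫⁻ a, ∫⁻ b, (F (a, b) : ℝ≥0∞) ^ (1 + s) ∂(outputDist K Q) ∂Q) ^ n := by
        rw [← lintegral_nFoldDensity_rpow hF (by linarith), ← lintegral_const_mul]
        · exact lintegral_congr fun x =>
            lintegral_const_mul _ (hFn.comp measurable_prodMk_left)
        · exact hFn.lintegral_prod_right'
    _ = _ := by
        rw [lintegral_rpow_eq_ofReal_mgf hF hJ hs1 hs, hce, ← ENNReal.ofReal_pow mgf_nonneg,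
          ← ENNReal.ofReal_mul (by positivity), mul_pow, mul_comm]

theorem exists_exp_neg_of_lt_one {r : ℝ} (h0 : 0 < r) (h1 : r < 1) :
    ∃ κ, 0 < κ ∧ ∀ n : ℕ, r ^ n = Real.exp (-(n * κ)) := by
  refine ⟨-Real.log r, by linarith [Real.log_neg h0 h1], fun n => ?_⟩
  rw [mul_neg, neg_neg, Real.exp_nat_mul, Real.exp_log h0]

/-- Above the mutual information the upper tail of the information density of the memoryless
extension is exponentially small. -/
theorem exists_upper_tail_le (hF : Measurable F)
    (hJ : jointDist K Q = (Q.prod (outputDist K Q)).withDensity fun p => (F p : ℝ≥0∞))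
    (hmgf : ∃ t : ℝ, 0 < t ∧
      Integrable (fun p => Real.exp (t * infoDensity K Q p)) (jointDist K Q))
    {γ : ℝ} (hγ : (mutualInfo K Q).toReal < γ) :
    ∃ κ, 0 < κ ∧ ∀ n : ℕ,
      ∫⁻ x, ∫⁻ y, {p | (Real.exp (n * γ)).toNNReal < nFoldDensity F n p}.indicator
          (fun p => (nFoldDensity F n p : ℝ≥0∞)) (x, y)
        ∂(Measure.pi fun _ => outputDist K Q) ∂(Measure.pi fun _ => Q)
      ≤ ENNReal.ofReal (Real.exp (-(n * κ))) := by
  rw [toReal_mutualInfo (by rw [hJ]; exact withDensity_absolutelyContinuous _ _)] at hγ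
  obtain ⟨s, hs0, hs, hlt⟩ := exists_mgf_mul_exp_lt_one_of_integral_lt
    (zero_mem_interior_integrableExpSet_infoDensity hF hJ hmgf) hγ
  obtain ⟨κ, hκ, hκe⟩ := exists_exp_neg_of_lt_one
    (mul_pos (mgf_pos hs) (Real.exp_pos _)) hlt
  refine ⟨κ, hκ, fun n => ?_⟩
  rw [← hκe]
  exact lintegral_indicator_nFoldDensity_le hF hJ (by linarith) hs n _ fun p hp =>
    coe_le_mul_rpow_of_lt hs0.le (Real.toNNReal_pos.2 (Real.exp_pos _)) hp

/-- Below the mutual information the lower tail of the information density of the memoryless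
extension is exponentially small. -/
theorem exists_lower_tail_le (hF : Measurable F)
    (hJ : jointDist K Q = (Q.prod (outputDist K Q)).withDensity fun p => (F p : ℝ≥0∞))
    (hmgf : ∃ t : ℝ, 0 < t ∧
      Integrable (fun p => Real.exp (t * infoDensity K Q p)) (jointDist K Q))
    {γ : ℝ} (hγ : γ < (mutualInfo K Q).toReal) :
    ∃ κ, 0 < κ ∧ ∀ n : ℕ,
      ∫⁻ x, ∫⁻ y, {p | nFoldDensity F n p ≤ (Real.exp (n * γ)).toNNReal}.indicator
          (fun p => (nFoldDensity F n p : ℝ≥0∞)) (x, y)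
        ∂(Measure.pi fun _ => outputDist K Q) ∂(Measure.pi fun _ => Q)
      ≤ ENNReal.ofReal (Real.exp (-(n * κ))) := by
  rw [toReal_mutualInfo (by rw [hJ]; exact withDensity_absolutelyContinuous _ _)] at hγ
  obtain ⟨s, hs1, hs0, hs, hlt⟩ := exists_mgf_mul_exp_lt_one_of_lt_integral
    (zero_mem_interior_integrableExpSet_infoDensity hF hJ hmgf) hγ
  obtain ⟨κ, hκ, hκe⟩ := exists_exp_neg_of_lt_one
    (mul_pos (mgf_pos hs) (Real.exp_pos _)) hlt
  refine ⟨κ, hκ, fun n => ?_⟩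
  rw [← hκe]
  exact lintegral_indicator_nFoldDensity_le hF hJ hs1 hs n _ fun p hp =>
    coe_le_mul_rpow_of_le hs0.le hp

end Chernoff

/-! ### Security from total variation -/

section Security

theorem IsChannelDensity.tvDist_le_outputDeviation {A B : Type*} [MeasurableSpace A]
    [MeasurableSpace B] {α : Measure A} {β : Measure B} [IsProbabilityMeasure β]
    {F : A × B → ℝ≥0} (hF : IsChannelDensity α β F) {M : ℕ} (C : Fin M → A) :
    tvDist ((M : ℝ≥0∞)⁻¹ • ∑ w, β.withDensity fun b => (F (C w, b) : ℝ≥0∞)) β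
      ≤ outputDeviation β F C := by
  refine Real.iSup_le (fun ⟨S, hS⟩ => ?_) (outputDeviation_nonneg β F C)
  have h1 : ∀ w, (β.withDensity fun b => (F (C w, b) : ℝ≥0∞)) S
      = ENNReal.ofReal (∫ b in S, (F (C w, b) : ℝ) ∂β) := fun w => by
    rw [withDensity_apply _ hS, ofReal_integral_eq_lintegral_ofReal
      (hF.integrable_right (C w)).integrableOn
      (Filter.Eventually.of_forall fun b => NNReal.coe_nonneg _)]
    simp
  have h2 : ((M : ℝ≥0∞)⁻¹ • ∑ w, β.withDensity fun b => (F (C w, b) : ℝ≥0∞)).real S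
      = ∫ b in S, (M : ℝ)⁻¹ * ∑ w, (F (C w, b) : ℝ) ∂β := by
    rw [integral_const_mul,
      integral_finsetSum _ fun w _ => (hF.integrable_right (C w)).integrableOn, Measure.real,
      Measure.smul_apply, Measure.finsetSum_apply]
    simp only [h1, smul_eq_mul, ENNReal.toReal_mul, ENNReal.toReal_inv, ENNReal.toReal_natCast]
    rw [ENNReal.toReal_sum fun _ _ => ENNReal.ofReal_ne_top]
    congr 1
    exact Finset.sum_congr rfl fun w _ => ENNReal.toReal_ofReal
      (integral_nonneg fun b => NNReal.coe_nonneg _)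
  have h3 : β.real S = ∫ _ in S, (1 : ℝ) ∂β := by simp
  have hi : Integrable (fun b => (M : ℝ)⁻¹ * ∑ w, (F (C w, b) : ℝ)) β :=
    (integrable_finsetSum _ fun w _ => hF.integrable_right (C w)).const_mul _
  change |_ - β.real S| ≤ _
  rw [h2, h3, ← integral_sub hi.integrableOn (integrable_const _)]
  refine abs_integral_le_integral_abs.trans ?_
  exact setIntegral_le_integral (hF.integrable_average C).abs
    (Filter.Eventually.of_forall fun b => abs_nonneg _)

theorem abs_real_sub_real_le_tvDist {B : Type*} [MeasurableSpace B] (μ ν : Measure B)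
    [IsProbabilityMeasure μ] [IsProbabilityMeasure ν] {S : Set B} (hS : MeasurableSet S) :
    |μ.real S - ν.real S| ≤ tvDist μ ν := by
  refine le_ciSup (f := fun F : {F : Set B // MeasurableSet F} => |μ.real F - ν.real F|)
    ⟨1, ?_⟩ ⟨S, hS⟩
  rintro _ ⟨F, rfl⟩
  refine abs_le.2 ⟨?_, ?_⟩ <;>
  linarith [measureReal_nonneg (μ := μ) (s := F.1), measureReal_nonneg (μ := ν) (s := F.1),
    measureReal_le_one (μ := μ) (s := F.1), measureReal_le_one (μ := ν) (s := F.1)]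

/-- If the output laws of all messages are close to a fixed law `ν`, then replacing them by `ν`
makes the output independent of the message, and no partition guess beats the best blind guess. -/
theorem advSS_le_of_tvDist_le {A B : Type*} [MeasurableSpace A] [MeasurableSpace B] {n L L₁ : ℕ}
    [NeZero L₁] (K : Kernel A B) [IsMarkovKernel K] (C : Codebook A n L L₁)
    (ν : Measure (Fin n → B)) [IsProbabilityMeasure ν] {δ : ℝ} (hδ : 0 ≤ δ)
    (h : ∀ m, tvDist (outputGivenMessage K C m) ν ≤ δ) : advSS K C ≤ δ := by
  classical
  refine Real.iSup_le (fun q => ?_) hδ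
  obtain ⟨⟨P, hP⟩, parti⟩ := q
  set best : ℝ := ⨆ π : parti.parts, P.real {m | m ∈ π.1}
  have hbest : ∀ π : parti.parts, P.real {m | m ∈ π.1} ≤ best := fun π =>
    le_ciSup (f := fun π : parti.parts => P.real {m | m ∈ π.1}) (Set.finite_range _).bddAbove π
  have hbest0 : 0 ≤ best := Real.iSup_nonneg fun _ => measureReal_nonneg
  rw [sub_le_iff_le_add]
  refine Real.iSup_le (fun ⟨g, hg⟩ => ?_) (add_nonneg hδ hbest0)
  have hSm : ∀ m, MeasurableSet {z | m ∈ (g z).1} := by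
    intro m
    have : {z | m ∈ (g z).1} = ⋃ π : {π : parti.parts // m ∈ π.1}, g ⁻¹' {π.1} := by
      ext z; simp
    rw [this]
    exact MeasurableSet.iUnion fun π => hg _
  have hS : MeasurableSet {p : Fin L × (Fin n → B) | p.1 ∈ (g p.2).1} := by
    have : {p : Fin L × (Fin n → B) | p.1 ∈ (g p.2).1}
        = ⋃ m : Fin L, {m} ×ˢ {z | m ∈ (g z).1} := by
      ext ⟨m, z⟩; simp
    rw [this]
    exact MeasurableSet.iUnion fun m => (measurableSet_singleton m).prod (hSm m)
  have hjoint : (P ⊗ₘ messageKernel K C).real {p | p.1 ∈ (g p.2).1}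
      = ∑ m, (messageKernel K C m).real {z | m ∈ (g z).1} * P.real {m} := by
    rw [Measure.real, Measure.compProd_apply hS, lintegral_fintype,
      ENNReal.toReal_sum fun m _ => ENNReal.mul_ne_top (measure_ne_top _ _) (measure_ne_top _ _)]
    exact Finset.sum_congr rfl fun m _ => ENNReal.toReal_mul
  have hPsum : ∑ m, P.real {m} = 1 := by
    rw [← measureReal_biUnion_finset (by simp [Set.PairwiseDisjoint, Set.Pairwise, Function.onFun])
      (fun m _ => measurableSet_singleton m)]
    have e : (⋃ m ∈ (Finset.univ : Finset (Fin L)), ({m} : Set (Fin L))) = Set.univ := by ext; simp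
    rw [e, probReal_univ]
  have hideal : ∑ m, ν.real {z | m ∈ (g z).1} * P.real {m} ≤ best := by
    have h1 : ∀ m, ν.real {z | m ∈ (g z).1} * P.real {m}
        = ∫ z, {z | m ∈ (g z).1}.indicator 1 z * P.real {m} ∂ν := fun m => by
      rw [integral_mul_const, integral_indicator_one (hSm m)]
    simp_rw [h1]
    have hi : ∀ m, Integrable
        (fun z => {z | m ∈ (g z).1}.indicator (1 : (Fin n → B) → ℝ) z * P.real {m}) ν := fun m =>
      ((integrable_const (1 : ℝ)).indicator (hSm m)).mul_const _
    rw [← integral_finsetSum _ fun m _ => hi m]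
    refine (integral_mono (integrable_finsetSum _ fun m _ => hi m) (integrable_const best)
      fun z => ?_).trans (by simp)
    refine le_trans (le_of_eq ?_) (hbest (g z))
    have e : {m | m ∈ (g z).1} = ⋃ m ∈ (g z).1, {m} := by ext; simp
    rw [e, measureReal_biUnion_finset
      (by simp [Set.PairwiseDisjoint, Set.Pairwise, Function.onFun])
      (fun m _ => measurableSet_singleton m)]
    simp [Set.indicator_apply, Finset.sum_ite_mem]
  change (P ⊗ₘ messageKernel K C).real {p | p.1 ∈ (g p.2).1} ≤ δ + best
  rw [hjoint]
  calc ∑ m, (messageKernel K C m).real {z | m ∈ (g z).1} * P.real {m}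
      ≤ ∑ m, (ν.real {z | m ∈ (g z).1} * P.real {m} + δ * P.real {m}) := by
        refine Finset.sum_le_sum fun m _ => ?_
        rw [← add_mul]
        refine mul_le_mul_of_nonneg_right ?_ measureReal_nonneg
        have h1 := abs_real_sub_real_le_tvDist (messageKernel K C m) ν (hSm m)
        have h2 := (abs_le.1 (h1.trans (h m))).2
        linarith
    _ = ∑ m, ν.real {z | m ∈ (g z).1} * P.real {m} + δ := by
        rw [Finset.sum_add_distrib, ← Finset.mul_sum, hPsum, mul_one]
    _ ≤ δ + best := by linarith

end Security

/-! ### Exponential rates -/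

section Rates

theorem eventually_mul_exp_neg_le {a b : ℝ} (hab : a < b) (c : ℝ) :
    ∀ᶠ n : ℕ in Filter.atTop, c * Real.exp (-(n * b)) ≤ Real.exp (-(n * a)) := by
  have h : Filter.Tendsto (fun n : ℕ => Real.exp (n * (b - a))) Filter.atTop Filter.atTop :=
    Real.tendsto_exp_atTop.comp
      (tendsto_natCast_atTop_atTop.atTop_mul_const (by linarith))
  filter_upwards [h.eventually_ge_atTop c] with n hn
  calc c * Real.exp (-(n * b)) ≤ Real.exp (n * (b - a)) * Real.exp (-(n * b)) := by gcongr
    _ = Real.exp (-(n * a)) := by rw [← Real.exp_add]; congr 1; ring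

/-- A doubly exponentially small probability survives a union bound over exponentially many
messages. -/
theorem eventually_two_mul_exp_mul_exp_neg_exp_le (R : ℝ) {δ : ℝ} (hδ : 0 < δ) :
    ∀ᶠ n : ℕ in Filter.atTop,
      2 * Real.exp (n * R) * Real.exp (-(Real.exp (n * δ) / 32)) ≤ Real.exp (-n) := by
  have h : Filter.Tendsto (fun n : ℕ => (n : ℝ) * (δ ^ 2 / 64)) Filter.atTop Filter.atTop :=
    tendsto_natCast_atTop_atTop.atTop_mul_const (by positivity)
  filter_upwards [h.eventually_ge_atTop (R + 2), Filter.eventually_ge_atTop 1] with n hn hn1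
  have hn1' : (1 : ℝ) ≤ n := by exact_mod_cast hn1
  have hq := Real.quadratic_le_exp_of_nonneg (x := n * δ) (by positivity)
  have h2 : (2 : ℝ) ≤ Real.exp 1 := by linarith [Real.add_one_le_exp (1 : ℝ)]
  have hmul : (n : ℝ) * (R + 2) ≤ n * (n * (δ ^ 2 / 64)) := by gcongr
  have hnd : 0 ≤ (n : ℝ) * δ := by positivity
  calc 2 * Real.exp (n * R) * Real.exp (-(Real.exp (n * δ) / 32))
      ≤ Real.exp 1 * Real.exp (n * R) * Real.exp (-(Real.exp (n * δ) / 32)) := by gcongr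
    _ = Real.exp (1 + n * R + -(Real.exp (n * δ) / 32)) := by rw [Real.exp_add, Real.exp_add]
    _ ≤ Real.exp (-n) := by
        refine Real.exp_le_exp.2 ?_
        nlinarith

theorem natCeil_exp_le_two_mul {x : ℝ} (hx : 0 ≤ x) :
    (⌈Real.exp x⌉₊ : ℝ) ≤ 2 * Real.exp x := by
  have h1 := Nat.ceil_lt_add_one (Real.exp_pos x).le
  have h2 := Real.one_le_exp hx
  linarith

end Rates

/-! ### Asymptotics of random codebooks -/

section Asymptotics

variable {A B : Type*} [MeasurableSpace A] [MeasurableSpace B] {K : Kernel A B} [IsMarkovKernel K]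
  {Q : Measure A} [IsProbabilityMeasure Q] {F : A × B → ℝ≥0}

/-- Soft covering at rates above the mutual information, with doubly exponentially small failure
probability. -/
theorem exists_resolvability_exponent (hF : IsChannelDensity Q (outputDist K Q) F)
    (hJ : jointDist K Q = (Q.prod (outputDist K Q)).withDensity fun p => (F p : ℝ≥0∞))
    (hmgf : ∃ t : ℝ, 0 < t ∧
      Integrable (fun p => Real.exp (t * infoDensity K Q p)) (jointDist K Q))
    {R : ℝ} (hR : (mutualInfo K Q).toReal < R) :
    ∃ ξ δ, 0 < ξ ∧ 0 < δ ∧ ∀ᶠ n : ℕ in Filter.atTop,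
      (Measure.pi fun _ : Fin ⌈Real.exp (n * R)⌉₊ => Measure.pi fun _ : Fin n => Q).real
        {c | Real.exp (-(n * ξ)) < outputDeviation (Measure.pi fun _ : Fin n => outputDist K Q)
          (nFoldDensity F n) c}
      ≤ Real.exp (-(Real.exp (n * δ) / 32)) := by
  set I := (mutualInfo K Q).toReal with hI
  have hI0 : 0 ≤ I := ENNReal.toReal_nonneg
  set γ := (I + R) / 2 with hγ
  obtain ⟨κ₀, hκ₀, htail⟩ := exists_upper_tail_le hF.measurable hJ hmgf (γ := γ) (by linarith)
  set κ := min κ₀ ((R - γ) / 2) with hκ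
  have hκ0 : 0 < κ := lt_min hκ₀ (by linarith)
  have hκ1 : κ ≤ (R - γ) / 2 := min_le_right _ _
  -- the mean is at most `3 e^{-nκ} ≤ e^{-nξ} / 2` with `ξ = κ / 2`; the other half of `e^{-nξ}` is
  -- the margin `t` in McDiarmid's inequality, whose exponent is `t² M / 8 ≥ e^{n(R - 2ξ)} / 32`
  refine ⟨κ / 2, R - κ, by positivity, by linarith, ?_⟩
  filter_upwards [eventually_mul_exp_neg_le (show κ / 2 < κ by linarith) 6] with n hn
  set M := ⌈Real.exp (n * R)⌉₊
  have hM : 0 < M := Nat.ceil_pos.2 (Real.exp_pos _)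
  have hMR : Real.exp (n * R) ≤ M := Nat.le_ceil _
  have hM' : (0 : ℝ) < M := by exact_mod_cast hM
  have hmean := (hF.nFold n).integral_outputDeviation_le hM (Real.exp_pos _).le (htail n)
  have hsqrt : √(((Real.exp (n * γ)).toNNReal : ℝ) / M) ≤ Real.exp (-(n * κ)) := by
    refine Real.sqrt_le_iff.2 ⟨(Real.exp_pos _).le, ?_⟩
    rw [Real.coe_toNNReal _ (Real.exp_pos _).le, div_le_iff₀ hM', ← Real.exp_nat_mul]
    calc Real.exp (n * γ) ≤ Real.exp ((2 : ℕ) * -(n * κ)) * Real.exp (n * R) := by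
          rw [← Real.exp_add]
          refine Real.exp_le_exp.2 ?_
          have : (n : ℝ) * (2 * κ) ≤ n * (R - γ) := by gcongr; linarith
          push_cast
          linarith
      _ ≤ _ := by gcongr
  have hκn : Real.exp (-(n * κ₀)) ≤ Real.exp (-(n * κ)) := by
    gcongr
    exact min_le_left _ _
  have hconc := (hF.nFold n).measure_outputDeviation_ge_le hM
    (t := Real.exp (-(n * (κ / 2))) / 2) (by positivity)
  refine (measureReal_mono fun c hc => ?_).trans (hconc.trans (Real.exp_le_exp.2 ?_))
  · have hc : Real.exp (-(n * (κ / 2))) < outputDeviation _ _ c := hc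
    change _ ≤ outputDeviation _ _ c
    linarith
  · have e : Real.exp (n * (R - κ)) = Real.exp (-(n * (κ / 2))) ^ 2 * Real.exp (n * R) := by
      rw [← Real.exp_nat_mul, ← Real.exp_add]
      congr 1
      push_cast
      ring
    have : Real.exp (n * (R - κ)) ≤ Real.exp (-(n * (κ / 2))) ^ 2 * M := by rw [e]; gcongr
    rw [div_pow]
    linarith

/-- Reliability of the threshold decoder at total rates below the mutual information. -/
theorem exists_reliability_exponent (hF : IsChannelDensity Q (outputDist K Q) F)
    (hJ : jointDist K Q = (Q.prod (outputDist K Q)).withDensity fun p => (F p : ℝ≥0∞))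
    (hmgf : ∃ t : ℝ, 0 < t ∧
      Integrable (fun p => Real.exp (t * infoDensity K Q p)) (jointDist K Q))
    {R R₁ : ℝ} (hR0 : 0 ≤ R) (hR₁0 : 0 ≤ R₁) (hR : R + R₁ < (mutualInfo K Q).toReal) :
    ∃ γ κ, 0 < κ ∧ ∀ᶠ n : ℕ in Filter.atTop,
      (codebookLaw Q n ⌈Real.exp (n * R)⌉₊ ⌈Real.exp (n * R₁)⌉₊).real
        {C | ENNReal.ofReal (Real.exp (-(n * κ))) <
          thresholdErrorBound (Measure.pi fun _ : Fin n => outputDist K Q) (nFoldDensity F n)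
            (Real.exp (n * γ)).toNNReal C}
      ≤ Real.exp (-(n * κ)) := by
  set I := (mutualInfo K Q).toReal
  set γ := (R + R₁ + I) / 2 with hγ
  obtain ⟨κ₀, hκ₀, htail⟩ := exists_lower_tail_le hF.measurable hJ hmgf (γ := γ) (by linarith)
  set κ := min κ₀ (γ - R - R₁) with hκ
  have hκ0 : 0 < κ := lt_min hκ₀ (by linarith)
  have hκ1 : κ ≤ γ - R - R₁ := min_le_right _ _
  -- the mean error bound is at most `5 e^{-nκ} ≤ (e^{-nκ/4})²`, which Markov's inequality splits
  refine ⟨γ, κ / 4, by positivity, ?_⟩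
  filter_upwards [eventually_mul_exp_neg_le (show κ / 4 + κ / 4 < κ by linarith) 5] with n hn
  set L := ⌈Real.exp (n * R)⌉₊
  set M := ⌈Real.exp (n * R₁)⌉₊
  set β := Measure.pi fun _ : Fin n => outputDist K Q
  set c := (Real.exp (n * γ)).toNNReal with hc
  have hc0 : 0 < c := Real.toNNReal_pos.2 (Real.exp_pos _)
  have hL : 0 < L := Nat.ceil_pos.2 (Real.exp_pos _)
  have hM : 0 < M := Nat.ceil_pos.2 (Real.exp_pos _)
  have hL2 : (L : ℝ) ≤ 2 * Real.exp (n * R) := natCeil_exp_le_two_mul (by positivity)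
  have hM2 : (M : ℝ) ≤ 2 * Real.exp (n * R₁) := natCeil_exp_le_two_mul (by positivity)
  set ε := Real.exp (-(n * (κ / 4)))
  have hε : 0 < ε := Real.exp_pos _
  have hmean : ∫⁻ C, thresholdErrorBound β (nFoldDensity F n) c C ∂(codebookLaw Q n L M)
      ≤ ENNReal.ofReal (ε * ε) := by
    refine ((hF.nFold n).lintegral_thresholdErrorBound_le hc0 hL hM).trans ?_
    have h1 : (L * M : ℝ≥0∞) * (c : ℝ≥0∞)⁻¹
        = ENNReal.ofReal (L * M * Real.exp (-(n * γ))) := by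
      rw [ENNReal.ofReal_mul (by positivity), ENNReal.ofReal_mul (by positivity), Real.exp_neg,
        ENNReal.ofReal_inv_of_pos (Real.exp_pos _), ENNReal.ofReal_natCast, ENNReal.ofReal_natCast]
      rfl
    rw [h1]
    refine (add_le_add_left (htail n) _).trans ?_
    rw [← ENNReal.ofReal_add (Real.exp_pos _).le (by positivity)]
    refine ENNReal.ofReal_le_ofReal ?_
    have h2 : Real.exp (-(n * κ₀)) ≤ Real.exp (-(n * κ)) := by
      gcongr
      exact min_le_left _ _
    have h3 : L * M * Real.exp (-(n * γ)) ≤ 4 * Real.exp (-(n * κ)) := by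
      calc L * M * Real.exp (-(n * γ))
          ≤ (2 * Real.exp (n * R)) * (2 * Real.exp (n * R₁)) * Real.exp (-(n * γ)) := by gcongr
        _ = 4 * Real.exp (-(n * (γ - R - R₁))) := by
            have : -((n : ℝ) * (γ - R - R₁)) = n * R + n * R₁ + -(n * γ) := by ring
            rw [this, Real.exp_add, Real.exp_add]
            ring
        _ ≤ 4 * Real.exp (-(n * κ)) := by gcongr
    have h4 : ε * ε = Real.exp (-(n * (κ / 4 + κ / 4))) := by
      rw [← Real.exp_add]; congr 1; ring
    rw [h4]
    linarith
  have hmeas := measurable_thresholdErrorBound (L := L) (L₁ := M) (β := β)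
    (hF.nFold n).measurable c
  have hmarkov := meas_ge_le_lintegral_div (μ := codebookLaw Q n L M) hmeas.aemeasurable
    (ENNReal.ofReal_pos.2 hε).ne' ENNReal.ofReal_ne_top
  refine ENNReal.toReal_le_of_le_ofReal hε.le ?_
  calc codebookLaw Q n L M {C | ENNReal.ofReal ε < thresholdErrorBound β (nFoldDensity F n) c C}
      ≤ codebookLaw Q n L M {C | ENNReal.ofReal ε ≤ thresholdErrorBound β (nFoldDensity F n) c C} :=
        measure_mono fun C (hC : ENNReal.ofReal ε < _) => hC.le
    _ ≤ ENNReal.ofReal (ε * ε) / ENNReal.ofReal ε :=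
        hmarkov.trans (ENNReal.div_le_div_right hmean _)
    _ = ENNReal.ofReal ε := by
        rw [← ENNReal.ofReal_div_of_pos hε, mul_div_assoc, div_self hε.ne', mul_one]

theorem outputGivenMessage_eq (hF : Measurable F) {n L L₁ : ℕ} {C : Codebook A n L L₁}
    (hC : ∀ m w i, K (C m w i)
      = (outputDist K Q).withDensity fun b => (F (C m w i, b) : ℝ≥0∞)) (m : Fin L) :
    outputGivenMessage K C m = (L₁ : ℝ≥0∞)⁻¹ • ∑ w, (Measure.pi fun _ => outputDist K Q).withDensity
      fun y => (nFoldDensity F n (C m w, y) : ℝ≥0∞) := by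
  unfold outputGivenMessage
  congr 1
  exact Finset.sum_congr rfl fun w _ => nFold_eq_withDensity hF (hC m w)

theorem exists_decoder_avgError_le (hF : Measurable F) {n L L₁ : ℕ} [NeZero L]
    {C : Codebook A n L L₁} (hC : ∀ m w i, K (C m w i)
      = (outputDist K Q).withDensity fun b => (F (C m w i, b) : ℝ≥0∞)) {c : ℝ≥0} {ε : ℝ}
    (hε : 0 ≤ ε) (h : thresholdErrorBound (Measure.pi fun _ => outputDist K Q)
      (nFoldDensity F n) c C ≤ ENNReal.ofReal ε) :
    ∃ D : (Fin n → B) → Fin L, Measurable D ∧ avgError K C D ≤ ε := by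
  have hFn : Measurable (nFoldDensity F n) := Finset.measurable_prod _ fun i _ => hF.comp
      (((measurable_pi_apply i).comp measurable_fst).prodMk
        ((measurable_pi_apply i).comp measurable_snd))
  obtain ⟨D, hDm, hD⟩ := exists_measurable_thresholdDecoder hFn c C
  refine ⟨D, hDm, ?_⟩
  have h1 := (average_error_le_thresholdErrorBound (β := Measure.pi fun _ => outputDist K Q)
    hFn hDm hD).trans h
  have hprob : ∀ m w, IsProbabilityMeasure (nFold K (C m w)) := fun m w => by
    unfold nFold; infer_instance
  have e : avgError K C D = (((L : ℝ≥0∞) * L₁)⁻¹ * ∑ m, ∑ w,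
      ((Measure.pi fun _ => outputDist K Q).withDensity
        fun y => (nFoldDensity F n (C m w, y) : ℝ≥0∞)) {y | D y ≠ m}).toReal := by
    simp only [← nFold_eq_withDensity hF (hC _ _)]
    rw [avgError, Finset.sum_comm, ENNReal.toReal_mul, ENNReal.toReal_inv, ENNReal.toReal_mul,
      ENNReal.toReal_natCast, ENNReal.toReal_natCast, ENNReal.toReal_sum fun m _ =>
        ENNReal.sum_ne_top.2 fun w _ => measure_ne_top _ _]
    congr 1
    refine Finset.sum_congr rfl fun m _ => ?_
    rw [ENNReal.toReal_sum fun w _ => measure_ne_top _ _]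
    rfl
  rw [e]
  exact ENNReal.toReal_le_of_le_ofReal hε h1

instance (n L L₁ : ℕ) : IsProbabilityMeasure (codebookLaw Q n L L₁) := by
  unfold codebookLaw
  infer_instance

theorem ae_codebookLaw_of_ae {p : A → Prop} (hp : ∀ᵐ a ∂Q, p a) (n L L₁ : ℕ) :
    ∀ᵐ C ∂(codebookLaw Q n L L₁), ∀ m w i, p (C m w i) := by
  refine ae_all_iff.2 fun m => ae_all_iff.2 fun w => ae_all_iff.2 fun i => ?_
  have h := (measurePreserving_eval (fun _ : Fin n => Q) i).comp
    (measurePreserving_codeword (α := Measure.pi fun _ : Fin n => Q) m w)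
  exact h.quasiMeasurePreserving.ae hp

end Asymptotics

end RISWiretap

/-! ### Secrecy and reliability of the random codebook -/

theorem mainTheorem1 {Θ X Y : Type*} {d : ℕ} {Z : Fin d → Type*}
    [MeasurableSpace X] [MeasurableSpace Y] [∀ j, MeasurableSpace (Z j)]
    (hd : 0 < d)
    (T : RISWiretap.RISWiretapChannel Θ X Y Z)
    (Q : Measure (X × X)) [IsProbabilityMeasure Q]
    (hY : RISWiretap.HasInfoDensity T.bobKernel Q)
    (hZ : ∀ j, RISWiretap.HasInfoDensity (T.eveKernel j) Q)
    (hmgfY : ∃ t : ℝ, 0 < t ∧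
      Integrable (fun p => Real.exp (t * RISWiretap.infoDensity T.bobKernel Q p))
        (RISWiretap.jointDist T.bobKernel Q))
    (hmgfZ : ∀ j, ∃ t : ℝ, 0 < t ∧
      Integrable (fun p => Real.exp (t * RISWiretap.infoDensity (T.eveKernel j) Q p))
        (RISWiretap.jointDist (T.eveKernel j) Q))
    (R_s : ℝ) (hR_s : 0 ≤ R_s)
    (hrate : R_s < (RISWiretap.mutualInfo T.bobKernel Q).toReal
      - ⨆ j, (RISWiretap.mutualInfo (T.eveKernel j) Q).toReal) :
    ∀ R₁ : ℝ,
      (⨆ j, (RISWiretap.mutualInfo (T.eveKernel j) Q).toReal) < R₁ →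
      R₁ < (RISWiretap.mutualInfo T.bobKernel Q).toReal - R_s →
      ∃ (ξ : Fin d → ℝ) (lam₁ lam₂ : ℝ), (∀ j, 0 < ξ j) ∧ 0 < lam₁ ∧ 0 < lam₂ ∧
        ∃ n₀ : ℕ, ∀ n : ℕ, n₀ ≤ n →
          ∃ G : Set (RISWiretap.Codebook (X × X) n
              ⌈Real.exp (n * R_s)⌉₊ ⌈Real.exp (n * R₁)⌉₊),
            MeasurableSet G ∧
            1 - Real.exp (-(n * lam₁)) ≤ (RISWiretap.codebookLaw Q n
              ⌈Real.exp (n * R_s)⌉₊ ⌈Real.exp (n * R₁)⌉₊).real G ∧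
            ∀ C ∈ G,
              (∀ j m, RISWiretap.tvDist (RISWiretap.outputGivenMessage (T.eveKernel j) C m)
                  (Measure.pi fun _ : Fin n => RISWiretap.outputDist (T.eveKernel j) Q)
                    ≤ Real.exp (-(n * ξ j))) ∧
              (∃ D : (Fin n → Y × Y) → Fin ⌈Real.exp (n * R_s)⌉₊, Measurable D ∧
                RISWiretap.avgError T.bobKernel C D ≤ Real.exp (-(n * lam₂))) ∧
              (∀ j, RISWiretap.advSS (T.eveKernel j) C ≤ 2 * Real.exp (-(n * ξ j))) := by
  intro R₁ hR₁ hR₁Y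
  have hI : ∀ j, (RISWiretap.mutualInfo (T.eveKernel j) Q).toReal < R₁ := fun j =>
    (le_ciSup (Set.finite_range fun j => (RISWiretap.mutualInfo (T.eveKernel j) Q).toReal).bddAbove
      j).trans_lt hR₁
  have hR₁0 : 0 ≤ R₁ := (Real.iSup_nonneg fun j => ENNReal.toReal_nonneg).trans hR₁.le
  obtain ⟨FY, hFY, hKY⟩ := hY.exists_isChannelDensity
  choose FZ hFZ hKZ using fun j => (hZ j).exists_isChannelDensity
  have hJY := RISWiretap.jointDist_eq_withDensity hFY.measurable.coe_nnreal_ennreal hKY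
  have hJZ := fun j =>
    RISWiretap.jointDist_eq_withDensity (hFZ j).measurable.coe_nnreal_ennreal (hKZ j)
  obtain ⟨γ, κ, hκ, hrel⟩ := RISWiretap.exists_reliability_exponent hFY hJY hmgfY hR_s hR₁0
    (by linarith)
  choose ξ δ hξ hδ hres using fun j =>
    RISWiretap.exists_resolvability_exponent (hFZ j) (hJZ j) (hmgfZ j) (hI j)
  -- on a measurable set of full measure the kernels are given by their densities
  obtain ⟨S, hSQ, hSm, hS⟩ := (hKY.and (ae_all_iff.2 hKZ)).exists_measurable_mem
  set lam := min κ 1 with hlam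
  have hlam0 : 0 < lam := lt_min hκ one_pos
  refine ⟨ξ, lam / 2, κ, hξ, by positivity, hκ, ?_⟩
  obtain ⟨n₀, hn₀⟩ := Filter.eventually_atTop.1 (hrel.and ((Filter.eventually_all.2 hres).and
    ((Filter.eventually_all.2 fun j =>
      RISWiretap.eventually_two_mul_exp_mul_exp_neg_exp_le R_s (hδ j)).and
    (RISWiretap.eventually_mul_exp_neg_le (show lam / 2 < lam by linarith) (d + 1)))))
  refine ⟨n₀, fun n hn => ?_⟩
  obtain ⟨h1, h2, h3, h4⟩ := hn₀ n hn
  set L := ⌈Real.exp (n * R_s)⌉₊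
  set L₁ := ⌈Real.exp (n * R₁)⌉₊
  have hL : NeZero L := ⟨(Nat.ceil_pos.2 (Real.exp_pos _)).ne'⟩
  have hL₁ : NeZero L₁ := ⟨(Nat.ceil_pos.2 (Real.exp_pos _)).ne'⟩
  have hL2 : (L : ℝ) ≤ 2 * Real.exp (n * R_s) := RISWiretap.natCeil_exp_le_two_mul (by positivity)
  set P := RISWiretap.codebookLaw Q n L L₁ with hP
  -- a codebook is bad if it leaves `S` (`E₀ᶜ`), if the output of Eve `j` for a message `m` deviates
  -- too much (`EZ j m`), or if the error bound of the threshold decoder is too large (`EY`)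
  set E₀ : Set (RISWiretap.Codebook (X × X) n L L₁) := {C | ∀ m w i, C m w i ∈ S} with hE₀
  set EZ : Fin d → Fin L → Set (RISWiretap.Codebook (X × X) n L L₁) := fun j m =>
    {C | Real.exp (-(n * ξ j)) < RISWiretap.outputDeviation
      (Measure.pi fun _ : Fin n => RISWiretap.outputDist (T.eveKernel j) Q)
      (RISWiretap.nFoldDensity (FZ j) n) (C m)} with hEZ
  set EY : Set (RISWiretap.Codebook (X × X) n L L₁) := {C | ENNReal.ofReal (Real.exp (-(n * κ))) <
    RISWiretap.thresholdErrorBound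
      (Measure.pi fun _ : Fin n => RISWiretap.outputDist T.bobKernel Q)
      (RISWiretap.nFoldDensity FY n) (Real.exp (n * γ)).toNNReal C} with hEY
  have hE₀m : MeasurableSet E₀ := by
    have : E₀ = ⋂ m, ⋂ w, ⋂ i, {C | C m w i ∈ S} := by ext C; simp [hE₀]
    rw [this]
    refine MeasurableSet.iInter fun m => MeasurableSet.iInter fun w =>
      MeasurableSet.iInter fun i => ?_
    have hm : Measurable fun C : RISWiretap.Codebook (X × X) n L L₁ => C m w i :=
      (measurable_pi_apply i).comp ((measurable_pi_apply w).comp (measurable_pi_apply m))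
    exact hm hSm
  have hdev : ∀ j, Measurable fun c : Fin L₁ → Fin n → X × X => RISWiretap.outputDeviation
      (Measure.pi fun _ : Fin n => RISWiretap.outputDist (T.eveKernel j) Q)
      (RISWiretap.nFoldDensity (FZ j) n) c := fun j =>
    ((hFZ j).nFold n).measurable_outputDeviation
  have hEZm : ∀ j m, MeasurableSet (EZ j m) := fun j m =>
    measurableSet_lt measurable_const ((hdev j).comp (measurable_pi_apply m))
  have hEYm : MeasurableSet EY := measurableSet_lt measurable_const
    (RISWiretap.measurable_thresholdErrorBound (hFY.nFold n).measurable _)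
  have hEZP : ∀ j m, P.real (EZ j m) ≤ Real.exp (-(Real.exp (n * δ j) / 32)) := by
    intro j m
    have hpre := (measurePreserving_eval (fun _ : Fin L => Measure.pi fun _ : Fin L₁ =>
      Measure.pi fun _ : Fin n => Q) m).measureReal_preimage
      (measurableSet_lt measurable_const (hdev j)).nullMeasurableSet
      (s := {c | Real.exp (-(n * ξ j)) < RISWiretap.outputDeviation
        (Measure.pi fun _ : Fin n => RISWiretap.outputDist (T.eveKernel j) Q)
        (RISWiretap.nFoldDensity (FZ j) n) c})
    exact hpre.le.trans (h2 j)
  have hE₀P : P.real E₀ᶜ = 0 := by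
    have := RISWiretap.ae_codebookLaw_of_ae hSQ n L L₁
    rw [Measure.real, show P E₀ᶜ = 0 from mem_ae_iff.1 this, ENNReal.toReal_zero]
  set G := (E₀ᶜ ∪ (⋃ j, ⋃ m, EZ j m) ∪ EY)ᶜ with hG
  have hbadm : MeasurableSet (E₀ᶜ ∪ (⋃ j, ⋃ m, EZ j m) ∪ EY) :=
    (hE₀m.compl.union (MeasurableSet.iUnion fun j => MeasurableSet.iUnion fun m => hEZm j m)).union
      hEYm
  refine ⟨G, hbadm.compl, ?_, ?_⟩
  · have hsec : P.real (⋃ j, ⋃ m, EZ j m) ≤ d * Real.exp (-n) := by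
      refine (measureReal_iUnion_fintype_le _).trans ?_
      have : ∀ j, P.real (⋃ m, EZ j m) ≤ Real.exp (-n) := fun j => by
        refine (measureReal_iUnion_fintype_le _).trans ?_
        refine (Finset.sum_le_card_nsmul _ _ _ fun m _ => hEZP j m).trans ?_
        simp only [Finset.card_univ, Fintype.card_fin, nsmul_eq_mul]
        refine le_trans ?_ (h3 j)
        gcongr
      exact (Finset.sum_le_card_nsmul _ _ _ fun j _ => this j).trans (by simp)
    have hbad : P.real (E₀ᶜ ∪ (⋃ j, ⋃ m, EZ j m) ∪ EY) ≤ Real.exp (-(n * (lam / 2))) := by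
      have u1 := measureReal_union_le (μ := P) (E₀ᶜ ∪ (⋃ j, ⋃ m, EZ j m)) EY
      have u2 := measureReal_union_le (μ := P) E₀ᶜ (⋃ j, ⋃ m, EZ j m)
      have u3 : Real.exp (-(n * κ)) ≤ Real.exp (-(n * lam)) := by
        gcongr
        exact min_le_left _ _
      have u4 : Real.exp (-n) ≤ Real.exp (-(n * lam)) := by
        refine Real.exp_le_exp.2 (neg_le_neg ?_)
        exact mul_le_of_le_one_right (Nat.cast_nonneg n) (min_le_right _ _)
      have u5 : (d : ℝ) * Real.exp (-n) ≤ d * Real.exp (-(n * lam)) := by gcongr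
      linarith
    rw [hG, probReal_compl_eq_one_sub hbadm]
    linarith
  · intro C hC
    simp only [hG, Set.mem_compl_iff, Set.mem_union, Set.mem_iUnion, not_or, not_exists,
      not_not] at hC
    obtain ⟨⟨hC0, hCZ⟩, hCY⟩ := hC
    have htv : ∀ j m, RISWiretap.tvDist (RISWiretap.outputGivenMessage (T.eveKernel j) C m)
        (Measure.pi fun _ : Fin n => RISWiretap.outputDist (T.eveKernel j) Q)
          ≤ Real.exp (-(n * ξ j)) := by
      intro j m
      rw [RISWiretap.outputGivenMessage_eq (hFZ j).measurable
        (fun m w i => (hS _ (hC0 m w i)).2 j) m]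
      exact (((hFZ j).nFold n).tvDist_le_outputDeviation (C m)).trans (not_lt.1 (hCZ j m))
    refine ⟨htv, ?_, fun j => ?_⟩
    · exact RISWiretap.exists_decoder_avgError_le hFY.measurable
        (fun m w i => (hS _ (hC0 m w i)).1) (Real.exp_pos _).le (not_lt.1 hCY)
    · refine (RISWiretap.advSS_le_of_tvDist_le (T.eveKernel j) C _ (Real.exp_pos _).le
        (htv j)).trans ?_
      linarith [Real.exp_pos (-(n * ξ j))]
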